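/- All graphs are finite, simple and undirected. A graph is $2$-edge-connected if it is connected and has no bridge (the empty graph and a single vertex count as $2$-edge-connected); a bridge of a graph is an edge whose ends lie in different connected components after its deletion. For a graph $G$ with vertex set $V$ and edge set $E(G)$ let $$\mathrm{TECSP}(G)=\operatorname{conv}\{\chi^{H} \mid H\subseteq G \text{ is a $2$-edge-connected subgraph}\}\subseteq\mathbb{R}^{E(G)},$$ where $\chi^H_e=1$ if $e\in E(H)$ and $\chi^H_e=0$ otherwise. For $\emptyset\subsetneq S\subsetneq V$ let $\delta(S)$ be the set of edges of $G$ with exactly one end in $S$; such sets are called cuts. For $x\in\mathbb{R}^{E(G)}$ and $F\subseteq E(G)$ put $x(F)=\sum_{e\in F}x_e$. An inequality defines a facet of $\mathrm{TECSP}(G)$ if it is valid on $\mathrm{TECSP}(G)$ and the face where it holds with equality has dimension $\dim\mathrm{TECSP}(G)-1$. **Theorem.** Let $G$ be a $2$-edge-connected graph with vertex set $V$, and let $\emptyset\subsetneq S\subsetneq V$ be such that $\delta(S)$ is an inclusion-wise minimal cut. Let $e_1\in E(G[S])$ and $e_2\in E(G[V\setminus S])$. For $W\in\{S,V\setminus S\}$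 and a bridge $f\notin\{e_1,e_2\}$ of $G[W]$, let $\delta(W,f)\subseteq\delta(S)$ be the set of edges of $\delta(S)$ that have an end in the connected component of $G[W]-f$ containing neither $e_1$ nor $e_2$. Then the connectivity cut inequality $$2x_{e_1}-x(\delta(S))+2x_{e_2}\le 2$$ defines a facet of $\mathrm{TECSP}(G)$ if and only if one of the following two conditions holds: (i) $e_1$ is a bridge of $G[S]$ or $e_2$ is a bridge of $G[V\setminus S]$, and $|\delta(S)|=2$; (ii) $e_1$ is not a bridge of $G[S]$, $e_2$ is not a bridge of $G[V\setminus S]$, and every bridge $f$ of $G[W]$, for $W\in\{S,V\setminus S\}$, satisfies $|\delta(W,f)|=1$. -/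

import Mathlib

namespace TECS

open SimpleGraph

variable {V : Type*}

/-- The cut `δ(S)`: the edges of `G` with exactly one end in `S`. -/
def cut (G : SimpleGraph V) (S : Set V) : Set (Sym2 V) :=
  {e | e ∈ G.edgeSet ∧ ∃ u ∈ S, ∃ v ∉ S, e = s(u, v)}

/-- `F` is a cut of `G`, i.e. `F = δ(T)` for some `∅ ⊊ T ⊊ V`. -/
def IsCut (G : SimpleGraph V) (F : Set (Sym2 V)) : Prop :=
  ∃ T : Set V, T.Nonempty ∧ T ≠ Set.univ ∧ F = cut G T

/-- The induced subgraph `G[W]`. -/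
def ind (G : SimpleGraph V) (W : Set V) : G.Subgraph :=
  (⊤ : G.Subgraph).induce W

/-- `f` is a bridge of the subgraph `H`: an edge of `H` whose ends are not connected in `H - f`.
Passing to `spanningCoe` only adds isolated vertices to `H`. Mathlib's `IsBridge` does not say that
`f` is an edge, so this is required separately. -/
def IsBridgeOf {G : SimpleGraph V} (H : G.Subgraph) (f : Sym2 V) : Prop :=
  f ∈ H.edgeSet ∧ H.spanningCoe.IsBridge f

/-- The set `δ(W, f)` for a bridge `f` of `G[W]`: the edges of the cut `δ(W) = δ(V ∖ W)` that have
an end `w ∈ W` in the connected component of `G[W] - f` containing neither `e₁` nor `e₂`. -/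
def bridgeCut (G : SimpleGraph V) (W : Set V) (e₁ e₂ f : Sym2 V) : Set (Sym2 V) :=
  {d | d ∈ cut G W ∧ ∃ w ∈ W, w ∈ d ∧
    ∀ u, (u ∈ e₁ ∨ u ∈ e₂) → ¬ ((ind G W).deleteEdges {f}).spanningCoe.Reachable w u}

/-- The incidence vector `χ^H ∈ {0,1}^{E(G)}` of a subgraph. -/
noncomputable def incVec {G : SimpleGraph V} (H : G.Subgraph) : G.edgeSet → ℝ :=
  Set.indicator {e : G.edgeSet | (e : Sym2 V) ∈ H.edgeSet} 1

/-- The 2-edge-connected subgraph polytope: the convex hull of the incidence vectors of all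
2-edge-connected subgraphs of `G` (not necessarily spanning or induced; the empty graph and
single vertices count as 2-edge-connected). -/
def TECSP (G : SimpleGraph V) : Set (G.edgeSet → ℝ) :=
  convexHull ℝ {x | ∃ H : G.Subgraph, H.coe.IsEdgeConnected 2 ∧ x = incVec H}

/-- The linear functional `x ↦ x(F) = ∑_{e ∈ F} x_e`, for a set `F` of edges of a finite graph. -/
noncomputable def edgeSum (G : SimpleGraph V) (F : Set (Sym2 V)) :
    (G.edgeSet → ℝ) →ₗ[ℝ] ℝ :=
  ∑ᶠ (e : G.edgeSet) (_ : (e : Sym2 V) ∈ F), LinearMap.proj e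

/-- The left-hand side `x ↦ 2 x_{e₁} - x(δ(S)) + 2 x_{e₂}` of the connectivity cut inequality. -/
noncomputable def connectivityCutForm (G : SimpleGraph V) (S : Set V) (e₁ e₂ : G.edgeSet) :
    (G.edgeSet → ℝ) →ₗ[ℝ] ℝ :=
  (2 : ℝ) • LinearMap.proj e₁ - edgeSum G (cut G S) + (2 : ℝ) • LinearMap.proj e₂

section Polytope

variable {E : Type*} [AddCommGroup E] [Module ℝ E]

open Classical in
/-- The dimension of a subset of a finite-dimensional space: the dimension of its affine hull,
with `dim ∅ = -1`. -/
noncomputable def affDim (P : Set E) : ℤ :=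
  if P.Nonempty then (Module.finrank ℝ (affineSpan ℝ P).direction : ℤ) else -1

/-- The inequality `a x ≤ b` defines a facet of `P`: it is valid on `P`, and the face
`{x ∈ P | a x = b}` has dimension `dim P - 1`. -/
def DefinesFacet (P : Set E) (a : E →ₗ[ℝ] ℝ) (b : ℝ) : Prop :=
  (∀ x ∈ P, a x ≤ b) ∧ affDim {x | x ∈ P ∧ a x = b} = affDim P - 1

end Polytope

end TECS

namespace TECS

open SimpleGraph

variable {V : Type*}

/-! Incidence vectors only see edge sets, so 2-edge-connected subgraphs are replaced by `Good` edge
sets. The origin belongs to the polytope and the right-hand side is nonzero, so the inequality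
defines a facet iff its roots span all incidence vectors. Dually (`definesFacet_iff`), every edge
weight that vanishes on all roots must vanish on all good sets. A root either contains `e₁` and `e₂`
and exactly two cut edges, or contains one of `e₁`, `e₂` and no cut edge.

Necessity: let `X` be a side of a bridge `f` of `G[S]`, away from `e₁` or with `f = e₁`. Every root
uses as many edges of `δ(S) ∩ δ(X)` as copies of `f`, so the difference of the two counts vanishes
on roots. Evaluated on `G` itself, it gives `|δ(S) ∩ δ(X)| = 1` (`RootsDetermine.ncard_side`). If `f
= e₁` this holds for both sides, hence `|δ(S)| = 2`.

Sufficiency rests on `Good.wt_eq_zero_of_through`: inside a good set `R`, a weight that vanishes on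
the good subsets through one fixed edge vanishes on all good subsets. Averaging over the cycle space
reduces this to closed trails, and an ear argument treats those. If `e₁` is a bridge and `|δ(S)| =
2`, every good set through `e₂` is a root, and the result applies directly.

If neither edge is a bridge, take the 2-edge-connected component (`core`) of each `eᵢ` on its side.
By the condition on bridges, whatever hangs off a core is attached by a two-edge cut made of a
bridge and one edge of `δ(S)`. Hence good sets crossing `δ(S)` touch both cores and absorb them
without using more cut edges; the cores are roots themselves and have weight zero. This shows that
the weight of a good set outside one core is zero (`Setup.wt_diff_core`), and, applied three times,
that its total weight is zero. -/

/-! ### Edge sets: connectivity and 2-edge-connectivity -/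

section EdgeSets

variable {G : SimpleGraph V} {F F' : Set (Sym2 V)} {u v w x y : V}

/-- `u` and `v` are joined by a walk of `G` all of whose edges lie in `F`. -/
def Joined (G : SimpleGraph V) (F : Set (Sym2 V)) (u v : V) : Prop :=
  ∃ p : G.Walk u v, ∀ e ∈ p.edges, e ∈ F

/-- The vertices covered by an edge set. -/
def covered (F : Set (Sym2 V)) : Set V := {v | ∃ e ∈ F, v ∈ e}

/-- `F` is the edge set of a 2-edge-connected subgraph of `G`. -/
structure Good (G : SimpleGraph V) (F : Set (Sym2 V)) : Prop where
  sub : F ⊆ G.edgeSet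
  bridgeless : ∀ u v, s(u, v) ∈ F → Joined G (F \ {s(u, v)}) u v
  conn : ∀ u ∈ covered F, ∀ v ∈ covered F, Joined G F u v

theorem Joined.refl (u : V) : Joined G F u u := ⟨.nil, by simp⟩

theorem Joined.symm (h : Joined G F u v) : Joined G F v u := by
  obtain ⟨p, hp⟩ := h
  exact ⟨p.reverse, by simpa using hp⟩

theorem Joined.trans (h : Joined G F u v) (h' : Joined G F v w) : Joined G F u w := by
  obtain ⟨p, hp⟩ := h
  obtain ⟨q, hq⟩ := h'
  refine ⟨p.append q, fun e he => ?_⟩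
  rw [Walk.edges_append, List.mem_append] at he
  exact he.elim (hp e) (hq e)

theorem Joined.mono (hF : F ⊆ F') (h : Joined G F u v) : Joined G F' u v := by
  obtain ⟨p, hp⟩ := h
  exact ⟨p, fun e he => hF (hp e he)⟩

theorem Joined.of_mem (hF : F ⊆ G.edgeSet) (h : s(u, v) ∈ F) : Joined G F u v := by
  have huv : G.Adj u v := hF h
  exact ⟨huv.toWalk, by simpa using h⟩

theorem joined_iff_reachable (hF : F ⊆ G.edgeSet) :
    Joined G F u v ↔ (fromEdgeSet F).Reachable u v := by
  constructor
  · rintro ⟨p, hp⟩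
    exact ⟨p.transfer _ fun e he => by
      simpa [edgeSet_fromEdgeSet] using
        ⟨hp e he, G.not_isDiag_of_mem_edgeSet (p.edges_subset_edgeSet he)⟩⟩
  · rintro ⟨p⟩
    have hp : ∀ e ∈ p.edges, e ∈ F := fun e he => by
      have := p.edges_subset_edgeSet he
      rw [edgeSet_fromEdgeSet] at this
      exact this.1
    exact ⟨p.transfer G fun e he => hF (hp e he), by simpa using hp⟩

theorem joined_of_mem_support (p : G.Walk u v) (hp : ∀ e ∈ p.edges, e ∈ F)
    (hx : x ∈ p.support) : Joined G F u x := by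
  classical
  exact ⟨p.takeUntil x hx, fun e he => hp e (p.edges_takeUntil_subset_edges hx he)⟩

theorem Joined.exists_isPath (h : Joined G F u v) :
    ∃ p : G.Walk u v, p.IsPath ∧ ∀ e ∈ p.edges, e ∈ F := by
  classical
  obtain ⟨p, hp⟩ := h
  exact ⟨p.bypass, p.bypass_isPath, fun e he => hp e (p.edges_bypass_subset_edges he)⟩

theorem mem_covered_left (h : s(u, v) ∈ F) : u ∈ covered F := ⟨_, h, by simp⟩

theorem mem_covered_right (h : s(u, v) ∈ F) : v ∈ covered F := ⟨_, h, by simp⟩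

theorem covered_mono (h : F ⊆ F') : covered F ⊆ covered F' :=
  fun _ ⟨e, he, hv⟩ => ⟨e, h he, hv⟩

theorem covered_union : covered (F ∪ F') = covered F ∪ covered F' := by
  ext v
  simp only [covered, Set.mem_ofPred_eq, Set.mem_union]
  grind

theorem good_empty : Good G (∅ : Set (Sym2 V)) :=
  ⟨by simp, by simp, by simp [covered]⟩

theorem Good.union (h : Good G F) (h' : Good G F') (hx : x ∈ covered F) (hx' : x ∈ covered F') :
    Good G (F ∪ F') where
  sub := Set.union_subset h.sub h'.sub
  bridgeless u v huv := by
    rcases huv with huv | huv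
    · exact (h.bridgeless u v huv).mono (by gcongr; simp)
    · exact (h'.bridgeless u v huv).mono (by gcongr; simp)
  conn := by
    have key : ∀ u ∈ covered (F ∪ F'), Joined G (F ∪ F') u x := by
      intro u hu
      rw [covered_union] at hu
      rcases hu with hu | hu
      · exact (h.conn u hu x hx).mono (by simp)
      · exact (h'.conn u hu x hx').mono (by simp)
    exact fun u hu v hv => (key u hu).trans (key v hv).symm

/-- Through every edge of a good set there is a closed trail inside the set. -/
theorem Good.exists_trail (h : Good G F) (huv : s(u, v) ∈ F) :
    ∃ p : G.Walk v u, p.IsTrail ∧ s(u, v) ∉ p.edges ∧ ∀ e ∈ p.edges, e ∈ F := by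
  obtain ⟨p, hp, hF⟩ := (h.bridgeless u v huv).symm.exists_isPath
  exact ⟨p, hp.isTrail, fun hmem => (hF _ hmem).2 rfl, fun e he => (hF e he).1⟩

/-- For `u = v` the two remaining pieces of the trail join the ends of the deleted edge; this is why
closed trails are bridgeless. -/
theorem joined_diff_of_mem_edges (p : G.Walk u v) (hp : p.IsTrail) (hxy : s(x, y) ∈ p.edges) :
    (Joined G (p.edgeSet \ {s(x, y)}) u x ∧ Joined G (p.edgeSet \ {s(x, y)}) y v) ∨
      (Joined G (p.edgeSet \ {s(x, y)}) u y ∧ Joined G (p.edgeSet \ {s(x, y)}) x v) := by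
  induction p with
  | nil => simp at hxy
  | @cons a b c h p ih =>
    rw [Walk.isTrail_cons] at hp
    rw [Walk.edges_cons, List.mem_cons] at hxy
    by_cases hmem : s(x, y) ∈ p.edges
    · have hne : s(a, b) ≠ s(x, y) := fun he => hp.2 (he ▸ hmem)
      have hab : Joined G ((Walk.cons h p).edgeSet \ {s(x, y)}) a b :=
        ⟨.cons h .nil, by simpa using hne⟩
      have hsub : p.edgeSet \ {s(x, y)} ⊆ (Walk.cons h p).edgeSet \ {s(x, y)} := by
        rw [Walk.edgeSet_cons]; gcongr; simp
      rcases ih hp.1 hmem with ⟨h1, h2⟩ | ⟨h1, h2⟩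
      · exact .inl ⟨hab.trans (h1.mono hsub), h2.mono hsub⟩
      · exact .inr ⟨hab.trans (h1.mono hsub), h2.mono hsub⟩
    · have he : s(x, y) = s(a, b) := hxy.resolve_right hmem
      have hj : Joined G ((Walk.cons h p).edgeSet \ {s(x, y)}) b c :=
        ⟨p, fun e hep => ⟨by simp [hep], fun h' => hmem (by rw [← h']; exact hep)⟩⟩
      rcases Sym2.eq_iff.1 he with ⟨rfl, rfl⟩ | ⟨rfl, rfl⟩
      · exact .inl ⟨.refl _, hj⟩
      · exact .inr ⟨.refl _, hj⟩

theorem mem_support_of_mem_covered {p : G.Walk u v} (hx : x ∈ covered p.edgeSet) :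
    x ∈ p.support := by
  obtain ⟨e, he, hxe⟩ := hx
  induction e with
  | h a b =>
    rcases Sym2.mem_iff.1 hxe with rfl | rfl
    · exact p.fst_mem_support_of_mem_edges he
    · exact p.snd_mem_support_of_mem_edges he

theorem good_of_isTrail {p : G.Walk u u} (hp : p.IsTrail) : Good G p.edgeSet where
  sub := p.edges_subset_edgeSet
  bridgeless x y hxy := by
    rcases joined_diff_of_mem_edges p hp hxy with ⟨h1, h2⟩ | ⟨h1, h2⟩
    · exact (h2.trans h1).symm
    · exact h2.trans h1
  conn x hx y hy :=
    (joined_of_mem_support p (fun _ he => he) (mem_support_of_mem_covered hx)).symm.trans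
      (joined_of_mem_support p (fun _ he => he) (mem_support_of_mem_covered hy))

/-! ### Cuts and how good sets meet them. -/

theorem mem_cut_iff {S : Set V} {e : Sym2 V} :
    e ∈ cut G S ↔ e ∈ G.edgeSet ∧ ∃ u ∈ S, ∃ v ∉ S, e = s(u, v) := Iff.rfl

theorem mk_mem_cut_iff {S : Set V} :
    s(u, v) ∈ cut G S ↔ G.Adj u v ∧ (u ∈ S ∧ v ∉ S ∨ u ∉ S ∧ v ∈ S) := by
  rw [mem_cut_iff]
  refine and_congr Iff.rfl ⟨?_, ?_⟩
  · rintro ⟨a, ha, b, hb, h⟩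
    rcases Sym2.eq_iff.1 h with ⟨rfl, rfl⟩ | ⟨rfl, rfl⟩
    · exact .inl ⟨ha, hb⟩
    · exact .inr ⟨hb, ha⟩
  · rintro (⟨h1, h2⟩ | ⟨h1, h2⟩)
    · exact ⟨u, h1, v, h2, rfl⟩
    · exact ⟨v, h2, u, h1, Sym2.eq_swap⟩

theorem cut_compl (S : Set V) : cut G Sᶜ = cut G S := by
  ext e
  induction e with
  | h a b => rw [mk_mem_cut_iff, mk_mem_cut_iff]; simp; tauto

theorem Joined.exists_mem_cut {X : Set V} (h : Joined G F u v) (hu : u ∈ X) (hv : v ∉ X) :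
    ∃ e ∈ F, e ∈ cut G X := by
  obtain ⟨p, hp⟩ := h
  obtain ⟨d, hd, h1, h2⟩ := p.exists_boundary_dart X hu hv
  exact ⟨d.edge, hp _ (List.mem_map_of_mem hd), d.edge_mem, d.fst, h1, d.snd, h2, rfl⟩

/-- A good set does not meet a cut in exactly one edge. -/
theorem Good.exists_ne_mem_cut {X : Set V} {e : Sym2 V} (h : Good G F) (he : e ∈ F)
    (hX : e ∈ cut G X) : ∃ e' ∈ F, e' ≠ e ∧ e' ∈ cut G X := by
  obtain ⟨-, a, ha, b, hb, rfl⟩ := hX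
  obtain ⟨e', he', hc⟩ := (h.bridgeless a b he).exists_mem_cut ha hb
  exact ⟨e', he'.1, he'.2, hc⟩

/-- A good set covering vertices on both sides of a cut meets the cut. -/
theorem Good.exists_mem_cut {X : Set V} (h : Good G F) (hu : u ∈ covered F) (hv : v ∈ covered F)
    (huX : u ∈ X) (hvX : v ∉ X) : ∃ e ∈ F, e ∈ cut G X :=
  (h.conn u hu v hv).exists_mem_cut huX hvX

theorem Good.mem_of_cut_eq_pair {X : Set V} {e f : Sym2 V} (h : Good G F) (hX : cut G X = {e, f})
    (he : e ∈ F) : f ∈ F := by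
  obtain ⟨e', he', hne, hc⟩ := h.exists_ne_mem_cut he (X := X) (by simp [hX])
  rw [hX] at hc
  rcases hc with rfl | rfl
  · exact absurd rfl hne
  · exact he'

/-- Splitting a walk at its first visit to `A`. -/
theorem exists_first_visit {A : Set V} (p : G.Walk u v) (hA : ∃ a ∈ p.support, a ∈ A) :
    ∃ w ∈ A, ∃ (q : G.Walk u w) (r : G.Walk w v), p = q.append r ∧
      (∀ a ∈ q.support, a ∈ A → a = w) ∧ (∀ e ∈ q.edges, ∃ a ∈ e, a ∉ A) ∧
      ∃ d, ∀ e ∈ q.edges, (∃ a ∈ e, a ∈ A) → e = d := by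
  induction p with
  | @nil a =>
    obtain ⟨b, hb, hbA⟩ := hA
    simp only [Walk.support_nil, List.mem_singleton] at hb
    subst hb
    -- The walk has no edges, so any value serves as the exceptional edge.
    exact ⟨b, hbA, .nil, .nil, by simpa using ⟨s(b, b)⟩⟩
  | @cons a b c h p ih =>
    by_cases ha : a ∈ A
    · exact ⟨a, ha, .nil, .cons h p, by simpa using ⟨s(a, b)⟩⟩
    by_cases hb : b ∈ A
    · refine ⟨b, hb, .cons h .nil, p, by simp, ?_, ?_, s(a, b), by simp⟩
      · intro x hx hxA
        simp only [Walk.support_cons, Walk.support_nil, List.mem_cons, List.not_mem_nil,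
          or_false] at hx
        exact hx.resolve_left fun hxa => ha (hxa ▸ hxA)
      · simp only [Walk.edges_cons, Walk.edges_nil, List.mem_singleton, forall_eq]
        exact ⟨a, by simp, ha⟩
    · obtain ⟨w, hw, q, r, rfl, h1, h2, d, h3⟩ := ih (by
        obtain ⟨b, hb, hbA⟩ := hA
        rw [Walk.support_cons, List.mem_cons] at hb
        exact ⟨b, hb.resolve_left (fun hba => ha (hba ▸ hbA)), hbA⟩)
      refine ⟨w, hw, .cons h q, r, by simp, ?_, ?_, d, ?_⟩
      · intro d hd hdA
        rw [Walk.support_cons, List.mem_cons] at hd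
        exact h1 d (hd.resolve_left (fun hda => ha (hda ▸ hdA))) hdA
      · intro e he
        rw [Walk.edges_cons, List.mem_cons] at he
        rcases he with rfl | he
        · exact ⟨a, by simp, ha⟩
        · exact h2 e he
      · rintro e he ⟨x, hx, hxA⟩
        rw [Walk.edges_cons, List.mem_cons] at he
        rcases he with rfl | he
        · rcases Sym2.mem_iff.1 hx with rfl | rfl
          · exact absurd hxA ha
          · exact absurd hxA hb
        · exact h3 e he ⟨x, hx, hxA⟩

theorem edgeSet_append (p : G.Walk u v) (q : G.Walk v w) :
    (p.append q).edgeSet = p.edgeSet ∪ q.edgeSet := by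
  ext e; simp [Walk.mem_edgeSet]

theorem edgeSet_reverse (p : G.Walk u v) : p.reverse.edgeSet = p.edgeSet := by
  ext e; simp [Walk.mem_edgeSet]

theorem isTrail_append_iff {p : G.Walk u v} {q : G.Walk v w} :
    (p.append q).IsTrail ↔ p.IsTrail ∧ q.IsTrail ∧ Disjoint p.edgeSet q.edgeSet := by
  rw [Walk.isTrail_append, Set.disjoint_left]
  simp [List.Disjoint, Walk.mem_edgeSet]

end EdgeSets

/-! ### Weights of edge sets -/

section Weights

variable {c : Sym2 V → ℝ} {F F' K : Set (Sym2 V)}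

/-- The total weight of an edge set. -/
noncomputable def wt (c : Sym2 V → ℝ) (F : Set (Sym2 V)) : ℝ := ∑ᶠ e ∈ F, c e

theorem wt_empty : wt c ∅ = 0 := finsum_mem_empty

theorem wt_singleton (e : Sym2 V) : wt c {e} = c e := finsum_mem_singleton

theorem wt_indicator_compl : wt (Kᶜ.indicator c) F = wt c (F \ K) := by
  rw [wt, wt, finsum_mem_def, finsum_mem_def, Set.indicator_indicator, Set.sdiff_eq]

theorem wt_indicator : wt (K.indicator c) F = wt c (F ∩ K) := by
  rw [wt, wt, finsum_mem_def, finsum_mem_def, Set.indicator_indicator]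

variable [Finite V]

theorem wt_union (h : Disjoint F F') : wt c (F ∪ F') = wt c F + wt c F' :=
  finsum_mem_union h (Set.toFinite _) (Set.toFinite _)

theorem wt_inter_add_wt_diff : wt c (F ∩ K) + wt c (F \ K) = wt c F :=
  finsum_mem_inter_add_sdiff K (Set.toFinite _)

theorem wt_union_eq_add_wt_diff : wt c (F ∪ K) = wt c K + wt c (F \ K) := by
  rw [← wt_union Set.disjoint_sdiff_right, Set.union_sdiff_self, Set.union_comm]

theorem wt_one : wt (1 : Sym2 V → ℝ) F = F.ncard := by
  rw [wt, Set.ncard_eq_toFinset_card F, finsum_mem_eq_finite_toFinset_sum _ (Set.toFinite F)]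
  simp

end Weights

/-! ### The cycle space -/

section CycleSpace

open Finset

variable {G : SimpleGraph V} {c : Sym2 V → ℝ}

theorem even_card_symmDiff {α : Type*} [DecidableEq α] {A B : Finset α} (hA : Even #A)
    (hB : Even #B) : Even #(symmDiff A B) := by
  have h1 := card_sdiff_add_card_inter A B
  have h2 := card_sdiff_add_card_inter B A
  rw [inter_comm] at h2
  have h3 : #(symmDiff A B) = #(A \ B) + #(B \ A) := by
    rw [symmDiff_def, sup_eq_union, card_union_of_disjoint disjoint_sdiff_sdiff]
  rw [Nat.even_iff] at *
  omega

open Classical in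
/-- All vertices have even degree in `Y`. -/
def EvenSet (Y : Finset (Sym2 V)) : Prop := ∀ x, Even #{e ∈ Y | x ∈ e}

open Classical in
theorem evenSet_symmDiff {Y Z : Finset (Sym2 V)} (hY : EvenSet Y) (hZ : EvenSet Z) :
    EvenSet (symmDiff Y Z) := by
  intro x
  have : (symmDiff Y Z).filter (x ∈ ·) = symmDiff (Y.filter (x ∈ ·)) (Z.filter (x ∈ ·)) := by
    ext e; simp [mem_symmDiff]; tauto
  rw [this]
  exact even_card_symmDiff (hY x) (hZ x)

open Classical in
theorem card_filter_edges {u v : V} {p : G.Walk u v} (hp : p.IsTrail) (x : V) :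
    #{e ∈ p.edges.toFinset | x ∈ e} = p.edges.countP (fun e => x ∈ e) := by
  rw [List.countP_eq_length_filter, ← List.toFinset_card_of_nodup (hp.edges_nodup.filter _),
    List.toFinset_filter]
  simp

open Classical in
theorem evenSet_of_isTrail {u : V} {p : G.Walk u u} (hp : p.IsTrail) :
    EvenSet p.edges.toFinset := by
  intro x
  rw [card_filter_edges hp, hp.even_countP_edges_iff]
  simp

-- Take a longest trail in `Y`. If its ends differ, its end `v` has odd degree in the trail but even
-- degree in `Y`, so an unused edge at `v` extends it.
open Classical in
theorem EvenSet.exists_closed_trail [Finite V] {Y : Finset (Sym2 V)} (hY : EvenSet Y)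
    (hG : (Y : Set (Sym2 V)) ⊆ G.edgeSet) (hne : Y.Nonempty) :
    ∃ (u : V) (p : G.Walk u u), p.IsTrail ∧ p.edgeSet ⊆ Y ∧ p.edgeSet.Nonempty := by
  obtain ⟨e₀, he₀⟩ := hne
  induction e₀ with
  | h a b =>
  have : Nonempty V := ⟨a⟩
  have hset : (fromEdgeSet (Y : Set (Sym2 V))).edgeSet = Y := by
    rw [edgeSet_fromEdgeSet, sdiff_eq_left, Set.disjoint_left]
    exact fun e he hd => G.not_isDiag_of_mem_edgeSet (hG he) hd
  have hadj {x y : V} : (fromEdgeSet (Y : Set (Sym2 V))).Adj x y ↔ s(x, y) ∈ Y := by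
    rw [← mem_edgeSet, hset, mem_coe]
  obtain ⟨u, v, p, hp, hmax⟩ :=
    Walk.exists_isTrail_forall_isTrail_length_le_length (fromEdgeSet (Y : Set (Sym2 V)))
  have hpY : ∀ e ∈ p.edges, e ∈ Y := fun e he => by
    have := p.edges_subset_edgeSet he
    rwa [hset] at this
  have huv : u = v := by
    by_contra huv
    have hodd : ¬ Even #{e ∈ p.edges.toFinset | v ∈ e} := by
      rw [card_filter_edges hp, hp.even_countP_edges_iff]
      simp [huv]
    have hsub : {e ∈ p.edges.toFinset | v ∈ e} ⊆ {e ∈ Y | v ∈ e} := by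
      gcongr
      exact fun e he => hpY e (by simpa using he)
    have hss : ¬ {e ∈ Y | v ∈ e} ⊆ {e ∈ p.edges.toFinset | v ∈ e} := fun h =>
      hodd (hsub.antisymm h ▸ hY v)
    obtain ⟨e, he, hne⟩ := not_subset.1 hss
    rw [mem_filter] at he hne
    obtain ⟨w, rfl⟩ := he.2
    have hnp : s(w, v) ∉ p.reverse.edges := fun hmem => by
      rw [Walk.edges_reverse, List.mem_reverse] at hmem
      rw [Sym2.eq_swap] at hmem
      exact hne ⟨by simpa using hmem, he.2⟩
    have := hmax _ _ (Walk.cons (hadj.2 (Sym2.eq_swap (a := v) ▸ he.1)) p.reverse)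
      (hp.reverse.cons _ hnp)
    simp at this
  subst huv
  refine ⟨u, p.transfer G fun e he => hG (hpY e he), by
    rw [Walk.isTrail_def, Walk.edges_transfer]; exact hp.edges_nodup, ?_, ?_⟩
  · rw [Walk.edgeSet_transfer]
    exact fun e he => hpY e he
  · rw [Walk.edgeSet_transfer]
    have := hmax _ _ (Walk.cons (hadj.2 he₀) .nil) (by simp)
    cases p with
    | nil => simp at this
    | @cons _ w _ h q => exact ⟨s(u, w), by simp⟩

-- Removing a closed trail leaves a smaller even set, so an even set is an edge-disjoint union of
-- closed trails.
open Classical in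
theorem EvenSet.wt_eq_zero [Finite V] {Y : Finset (Sym2 V)} (hY : EvenSet Y)
    (hG : (Y : Set (Sym2 V)) ⊆ G.edgeSet)
    (hc : ∀ (u : V) (p : G.Walk u u), p.IsTrail → p.edgeSet ⊆ Y → wt c p.edgeSet = 0) :
    wt c Y = 0 := by
  induction hn : #Y using Nat.strong_induction_on generalizing Y with
  | _ n ih =>
  rcases Y.eq_empty_or_nonempty with rfl | hne
  · simp [wt_empty]
  obtain ⟨u, p, hp, hpY, e, he⟩ := hY.exists_closed_trail hG hne
  have hsub : p.edges.toFinset ⊆ Y := fun e he => hpY (by simpa using he)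
  have hdiff : symmDiff Y p.edges.toFinset = Y \ p.edges.toFinset := by
    rw [symmDiff_of_ge (by exact hsub)]
  have heven : EvenSet (Y \ p.edges.toFinset) := hdiff ▸ evenSet_symmDiff hY (evenSet_of_isTrail hp)
  have hcoe : ((Y \ p.edges.toFinset : Finset (Sym2 V)) : Set (Sym2 V)) =
      (Y : Set (Sym2 V)) \ p.edgeSet := by
    rw [coe_sdiff, Walk.coe_edges_toFinset]
  have hlt : #(Y \ p.edges.toFinset) < n := by
    rw [← hn]
    refine card_lt_card (sdiff_ssubset hsub ⟨e, by simpa using he⟩)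
  have h1 := ih _ hlt heven (by rw [hcoe]; exact Set.sdiff_subset.trans hG)
    (fun v q hq hqY => hc v q hq (by rw [hcoe] at hqY; exact hqY.trans Set.sdiff_subset)) rfl
  rw [hcoe] at h1
  have h2 := wt_inter_add_wt_diff (c := c) (F := (Y : Set (Sym2 V))) (K := p.edgeSet)
  rw [h1, Set.inter_eq_right.2 hpY, hc u p hp hpY] at h2
  linarith

open Classical in
/-- If every edge of `F` lies on a closed trail in `F`, then a weight vanishing on all closed trails
in `F` vanishes on `F`: every edge lies in exactly half of the even subsets of `F`. -/
theorem wt_eq_zero_of_closed_trails [Finite V] {F : Set (Sym2 V)} (hF : F ⊆ G.edgeSet)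
    (hcov : ∀ e ∈ F, ∃ (u : V) (p : G.Walk u u), p.IsTrail ∧ p.edgeSet ⊆ F ∧ e ∈ p.edgeSet)
    (hc : ∀ (u : V) (p : G.Walk u u), p.IsTrail → p.edgeSet ⊆ F → wt c p.edgeSet = 0) :
    wt c F = 0 := by
  have := Fintype.ofFinite V
  set E : Finset (Sym2 V) := F.toFinset with hE
  have hEF : (E : Set (Sym2 V)) = F := by simp [hE]
  set C : Finset (Finset (Sym2 V)) := {Y ∈ E.powerset | EvenSet Y} with hC
  have hsum : ∑ Y ∈ C, wt c Y = 0 := by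
    refine sum_eq_zero fun Y hY => ?_
    rw [hC, mem_filter, mem_powerset] at hY
    have hYF : (Y : Set (Sym2 V)) ⊆ F := by rw [← hEF]; exact_mod_cast hY.1
    exact hY.2.wt_eq_zero (hYF.trans hF) fun u p hp hpY => hc u p hp (hpY.trans hYF)
  have hhalf : ∀ e ∈ E, 2 * #{Y ∈ C | e ∈ Y} = #C := by
    intro e he
    obtain ⟨u, p, hp, hpF, hep⟩ := hcov e (by simpa [hE] using he)
    have hpE : p.edges.toFinset ⊆ E := fun e he => by
      rw [← mem_coe, hEF]; exact hpF (by simpa using he)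
    have hmem : e ∈ p.edges.toFinset := by simpa using hep
    have hmap : ∀ Y ∈ C, symmDiff Y p.edges.toFinset ∈ C := by
      intro Y hY
      rw [hC, mem_filter, mem_powerset] at hY ⊢
      exact ⟨symmDiff_le_sup.trans (sup_le hY.1 hpE),
        evenSet_symmDiff hY.2 (evenSet_of_isTrail hp)⟩
    -- Symmetric difference with a closed trail through `e` is an involution of the even sets that
    -- toggles `e`.
    have hbij : #{Y ∈ C | e ∈ Y} = #{Y ∈ C | ¬ e ∈ Y} := by
      refine card_nbij' (fun Y => symmDiff Y p.edges.toFinset)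
        (fun Y => symmDiff Y p.edges.toFinset) ?_ ?_ ?_ ?_
      · intro Y hY
        simp only [coe_filter, Set.mem_ofPred_eq] at hY ⊢
        exact ⟨hmap Y hY.1, by simp only [mem_symmDiff]; tauto⟩
      · intro Y hY
        simp only [coe_filter, Set.mem_ofPred_eq] at hY ⊢
        exact ⟨hmap Y hY.1, by simp only [mem_symmDiff]; tauto⟩
      · intro Y _; exact symmDiff_symmDiff_cancel_right _ _
      · intro Y _; exact symmDiff_symmDiff_cancel_right _ _
    have := card_filter_add_card_filter_not (s := C) (fun Y => e ∈ Y)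
    omega
  have hcomm : ∑ Y ∈ C, wt c Y = ∑ e ∈ E, #{Y ∈ C | e ∈ Y} * c e := by
    have h1 : ∀ Y ∈ C, wt c Y = ∑ e ∈ E, if e ∈ Y then c e else 0 := by
      intro Y hY
      rw [hC, mem_filter, mem_powerset] at hY
      rw [wt, finsum_mem_coe_finset, ← sum_filter, filter_mem_eq_inter, inter_eq_right.2 hY.1]
    rw [sum_congr rfl h1, sum_comm]
    refine sum_congr rfl fun e _ => ?_
    rw [← sum_filter, sum_const, nsmul_eq_mul]
  have hpos : 0 < #C := card_pos.2 ⟨∅, by rw [hC, mem_filter]; exact ⟨by simp, fun x => by simp⟩⟩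
  have hmul : (#C : ℝ) * wt c F = 0 := by
    rw [← hEF, wt, finsum_mem_coe_finset, mul_sum]
    calc ∑ e ∈ E, (#C : ℝ) * c e = ∑ e ∈ E, 2 * (#{Y ∈ C | e ∈ Y} * c e) := by
          refine sum_congr rfl fun e he => ?_
          rw [← hhalf e he]; push_cast; ring
      _ = 0 := by rw [← mul_sum, ← hcomm, hsum, mul_zero]
  rcases mul_eq_zero.1 hmul with h | h
  · exact absurd h (by exact_mod_cast hpos.ne')
  · exact h

/-- A weight vanishing on the closed trails in a good set vanishes on it. -/
theorem Good.wt_eq_zero [Finite V] {F : Set (Sym2 V)} (h : Good G F)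
    (hc : ∀ (u : V) (p : G.Walk u u), p.IsTrail → p.edgeSet ⊆ F → wt c p.edgeSet = 0) :
    wt c F = 0 := by
  refine wt_eq_zero_of_closed_trails h.sub (fun e he => ?_) hc
  induction e with
  | h a b =>
    obtain ⟨p, hp, hne, hpF⟩ := h.exists_trail he
    have hab : G.Adj a b := h.sub he
    exact ⟨a, .cons hab p, hp.cons hab hne, by
      rw [Walk.edgeSet_cons]; exact Set.insert_subset he hpF, by simp⟩

end CycleSpace

/-! ### Weights vanishing on the good sets through an edge -/

section ThroughEdge

variable {G : SimpleGraph V} {c : Sym2 V → ℝ} {R : Set (Sym2 V)} {g : Sym2 V}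

/-- A closed trail that visits `A` contains an ear of `A` through a given edge. -/
theorem exists_ear {A : Set V} {y y' : V} (h : G.Adj y y') (p : G.Walk y' y) (hp : p.IsTrail)
    (hyp : s(y, y') ∉ p.edges) (hA : ∃ a ∈ p.support, a ∈ A) :
    ∃ z ∈ A, ∃ z' ∈ A, ∃ W : G.Walk z' z, W.IsTrail ∧ s(y, y') ∈ W.edgeSet ∧
      W.edgeSet ⊆ insert s(y, y') p.edgeSet ∧
      ∀ e ∈ W.edgeSet, e ≠ s(y, y') → ∃ a ∈ e, a ∉ A := by
  -- The ear follows the trail from the edge `yy'` in both directions until it first meets `A`.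
  obtain ⟨z, hz, q, r, rfl, -, hq, -⟩ := exists_first_visit p hA
  obtain ⟨z', hz', q', r', hr, -, hq', -⟩ := exists_first_visit r.reverse (A := A) ⟨z, by simp, hz⟩
  have hsub : q'.edgeSet ⊆ r.edgeSet := by
    rw [← edgeSet_reverse r, hr, edgeSet_append]; simp
  rw [isTrail_append_iff] at hp
  have hq't : q'.IsTrail := by
    have := hp.2.1.reverse
    rw [hr, isTrail_append_iff] at this
    exact this.1
  have hyq : s(y, y') ∉ q.edgeSet := fun hm => hyp (by
    rw [Walk.edges_append, List.mem_append]; exact .inl hm)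
  have hyq' : s(y, y') ∉ q'.edgeSet := fun hm => hyp (by
    rw [Walk.edges_append, List.mem_append]; exact .inr (hsub hm))
  refine ⟨z, hz, z', hz', q'.reverse.append (.cons h q), ?_, ?_, ?_, ?_⟩
  · rw [isTrail_append_iff]
    refine ⟨hq't.reverse, hp.1.cons h hyq, ?_⟩
    rw [edgeSet_reverse, Walk.edgeSet_cons, Set.disjoint_insert_right]
    exact ⟨hyq', (hp.2.2.mono_right hsub).symm⟩
  · rw [edgeSet_append]; simp
  · rw [edgeSet_append, edgeSet_append, edgeSet_reverse, Walk.edgeSet_cons]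
    grind
  · intro e he hne
    rw [edgeSet_append, edgeSet_reverse, Walk.edgeSet_cons] at he
    rcases he with he | rfl | he
    · exact hq' e he
    · exact absurd rfl hne
    · exact hq e he

/-- Two vertices of a closed trail split it into two arcs. -/
theorem exists_arcs {u z z' : V} (p : G.Walk u u) (hp : p.IsTrail) (hz : z ∈ p.support)
    (hz' : z' ∈ p.support) :
    ∃ (P : G.Walk z z') (Q : G.Walk z' z), P.IsTrail ∧ Q.IsTrail ∧
      Disjoint P.edgeSet Q.edgeSet ∧ P.edgeSet ∪ Q.edgeSet = p.edgeSet := by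
  classical
  have hmem : z' ∈ (p.rotate z hz).support := by rwa [Walk.mem_support_rotate_iff]
  have ht := (Walk.isTrail_rotate hz).2 hp
  have hspec := (p.rotate z hz).take_spec hmem
  rw [← hspec, isTrail_append_iff] at ht
  refine ⟨_, _, ht.1, ht.2.1, ht.2.2, ?_⟩
  rw [← edgeSet_append, hspec]
  ext e
  exact (p.rotate_edges z hz).mem_iff

/-- The ear ends split `p` into arcs `P` and `Q`. With `D = T ∪ W`, the sets `D ∪ P`, `D ∪ Q` and `D
∪ P ∪ Q` are all good and contain `g`; comparing their weights gives `wt P = wt Q = 0`. The case `T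
= ∅` is for an ear that contains `g` itself. -/
theorem wt_closed_trail_eq_zero_of_ear [Finite V] {T : Set (Sym2 V)} {u y y' z z' : V}
    {p : G.Walk u u} {W : G.Walk z' z} (hp : p.IsTrail) (hpR : p.edgeSet ⊆ R)
    (hz : z ∈ p.support) (hz' : z' ∈ p.support) (hW : W.IsTrail) (hy : s(y, y') ∈ W.edgeSet)
    (hT : T = ∅ ∨ Good G T ∧ y ∈ covered T) (hTR : T ⊆ R) (hWR : W.edgeSet ⊆ R)
    (hTp : Disjoint T p.edgeSet) (hWp : Disjoint W.edgeSet p.edgeSet)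
    (hg : g ∈ T ∪ W.edgeSet)
    (hc : ∀ J, Good G J → J ⊆ R → g ∈ J → wt c J = 0) : wt c p.edgeSet = 0 := by
  obtain ⟨P, Q, hP, hQ, hPQ, hun⟩ := exists_arcs p hp hz hz'
  have hPp : P.edgeSet ⊆ p.edgeSet := hun ▸ Set.subset_union_left
  have hQp : Q.edgeSet ⊆ p.edgeSet := hun ▸ Set.subset_union_right
  set D := T ∪ W.edgeSet with hD
  have hDp : Disjoint D p.edgeSet := Set.disjoint_union_left.2 ⟨hTp, hWp⟩
  have hDR : D ⊆ R := Set.union_subset hTR hWR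
  have hyW : y ∈ covered W.edgeSet := mem_covered_left hy
  have hgood : ∀ B : G.Walk z z', B.IsTrail → B.edgeSet ⊆ p.edgeSet → Good G (D ∪ B.edgeSet) := by
    intro B hB hBp
    have h1 : Good G (W.edgeSet ∪ B.edgeSet) := by
      rw [← edgeSet_append]
      exact good_of_isTrail (isTrail_append_iff.2 ⟨hW, hB, hWp.mono_right hBp⟩)
    rw [hD, Set.union_assoc]
    rcases hT with rfl | ⟨hT, hyT⟩
    · simpa using h1
    · exact hT.union h1 hyT (covered_mono Set.subset_union_left hyW)
  have hgP := hgood P hP hPp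
  have hgQ := hgood Q.reverse hQ.reverse (by rwa [edgeSet_reverse])
  rw [edgeSet_reverse] at hgQ
  have hyD : y ∈ covered D := covered_mono Set.subset_union_right hyW
  have hgPQ := hgP.union hgQ (covered_mono Set.subset_union_left hyD)
    (covered_mono Set.subset_union_left hyD)
  rw [← Set.union_union_distrib_left, hun] at hgPQ
  have e1 := hc _ hgP (Set.union_subset hDR (hPp.trans hpR)) (.inl hg)
  have e2 := hc _ hgQ (Set.union_subset hDR (hQp.trans hpR)) (.inl hg)
  have e3 := hc _ hgPQ (Set.union_subset hDR hpR) (.inl hg)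
  rw [wt_union (hDp.mono_right hPp)] at e1
  rw [wt_union (hDp.mono_right hQp)] at e2
  rw [wt_union hDp] at e3
  have e4 : wt c p.edgeSet = wt c P.edgeSet + wt c Q.edgeSet := by rw [← hun, wt_union hPQ]
  linarith

/-- If `g` is off `p`, take a maximal good set `T` through `g` that is vertex-disjoint from `p`. An
edge of `R` leaving `T` lies on a closed trail in `R`, which must hit `p` by maximality and so
supplies an ear. If no such `T` exists, a closed trail through `g` already hits `p`. -/
theorem Good.wt_closed_trail_eq_zero [Finite V] (hR : Good G R) (hg : g ∈ R)
    (hc : ∀ J, Good G J → J ⊆ R → g ∈ J → wt c J = 0) {u : V} (p : G.Walk u u) (hp : p.IsTrail)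
    (hpR : p.edgeSet ⊆ R) : wt c p.edgeSet = 0 := by
  by_cases hgp : g ∈ p.edgeSet
  · exact hc _ (good_of_isTrail hp) hpR hgp
  set A := covered p.edgeSet with hA
  have hAs : ∀ a ∈ A, a ∈ p.support := fun a ha => mem_support_of_mem_covered ha
  have hdisj : ∀ {T : Set (Sym2 V)}, (∀ e ∈ T, ∃ a ∈ e, a ∉ A) → Disjoint T p.edgeSet := by
    intro T hT
    rw [Set.disjoint_left]
    intro e he hep
    obtain ⟨a, hae, haA⟩ := hT e he
    exact haA ⟨e, hep, hae⟩
  by_cases hex : ∃ T, Good G T ∧ T ⊆ R ∧ g ∈ T ∧ Disjoint (covered T) A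
  · obtain ⟨T, ⟨hT, hTR, hgT, hTA⟩, hmax⟩ :=
      (Set.toFinite {T | Good G T ∧ T ⊆ R ∧ g ∈ T ∧ Disjoint (covered T) A}).exists_maximal hex
    have hTp : Disjoint T p.edgeSet := by
      refine hdisj fun e he => ?_
      induction e with
      | h a b =>
        exact ⟨a, by simp, Set.disjoint_left.1 hTA (mem_covered_left he)⟩
    rcases A.eq_empty_or_nonempty with hemp | ⟨a, ha⟩
    · have : p.edgeSet = ∅ := by
        by_contra hne
        obtain ⟨e, he⟩ := Set.nonempty_iff_ne_empty.2 hne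
        induction e with
        | h a b =>
          have : a ∈ A := mem_covered_left he
          simp [hemp] at this
      rw [this, wt_empty]
    obtain ⟨x, hx⟩ : (covered T).Nonempty := by
      induction g with
      | h a b => exact ⟨a, mem_covered_left hgT⟩
    obtain ⟨e, heR, -, y, hy, y', hy', rfl⟩ := hR.exists_mem_cut (covered_mono hTR hx)
      (covered_mono hpR ha) hx (Set.disjoint_right.1 hTA ha)
    have hadj : G.Adj y y' := hR.sub heR
    obtain ⟨q, hq, hyq, hqR⟩ := hR.exists_trail heR
    have hcons : (Walk.cons hadj q).IsTrail := hq.cons hadj hyq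
    have hhit : ∃ a ∈ q.support, a ∈ A := by
      by_contra! hno
      have hle := hmax (y := T ∪ (Walk.cons hadj q).edgeSet) ⟨hT.union (good_of_isTrail hcons) hy
        (mem_covered_left (v := y') (by simp)), Set.union_subset hTR (by
          rw [Walk.edgeSet_cons]; exact Set.insert_subset heR hqR), .inl hgT, by
          rw [covered_union, Set.disjoint_union_left]
          refine ⟨hTA, Set.disjoint_left.2 fun b hb => ?_⟩
          have := mem_support_of_mem_covered hb
          rw [Walk.support_cons, List.mem_cons] at this
          rcases this with rfl | this
          · exact hno _ q.end_mem_support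
          · exact hno b this⟩ Set.subset_union_left
      exact hy' (mem_covered_right (u := y) (hle (.inr (by simp))))
    obtain ⟨z, hz, z', hz', W, hW, hyW, hWsub, hWA⟩ := exists_ear hadj q hq hyq hhit
    refine wt_closed_trail_eq_zero_of_ear hp hpR (hAs z hz) (hAs z' hz') hW hyW (.inr ⟨hT, hy⟩) hTR
      (hWsub.trans (Set.insert_subset heR hqR)) hTp (hdisj fun e he => ?_) (.inl hgT) hc
    by_cases hey : e = s(y, y')
    · exact ⟨y, by simp [hey], Set.disjoint_left.1 hTA hy⟩
    · exact hWA e he hey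
  · induction g with
    | h y y' =>
    have hadj : G.Adj y y' := hR.sub hg
    obtain ⟨q, hq, hyq, hqR⟩ := hR.exists_trail hg
    have hcons : (Walk.cons hadj q).IsTrail := hq.cons hadj hyq
    have hhit : ∃ a ∈ q.support, a ∈ A := by
      by_contra! hno
      refine hex ⟨(Walk.cons hadj q).edgeSet, good_of_isTrail hcons, by
        rw [Walk.edgeSet_cons]; exact Set.insert_subset hg hqR, by simp, ?_⟩
      refine Set.disjoint_left.2 fun b hb => ?_
      have := mem_support_of_mem_covered hb
      rw [Walk.support_cons, List.mem_cons] at this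
      rcases this with rfl | this
      · exact hno _ q.end_mem_support
      · exact hno b this
    obtain ⟨z, hz, z', hz', W, hW, hyW, hWsub, hWA⟩ := exists_ear hadj q hq hyq hhit
    refine wt_closed_trail_eq_zero_of_ear (T := ∅) hp hpR (hAs z hz) (hAs z' hz') hW hyW (.inl rfl)
      (by simp) (hWsub.trans (Set.insert_subset hg hqR)) (by simp) ?_ (.inr hyW) hc
    rw [Set.disjoint_left]
    intro e he hep
    by_cases hey : e = s(y, y')
    · exact hgp (hey ▸ hep)
    · obtain ⟨a, hae, haA⟩ := hWA e he hey
      exact haA ⟨e, hep, hae⟩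

/-- A weight vanishing on all good subsets of `R` through `g` vanishes on all good subsets. -/
theorem Good.wt_eq_zero_of_through [Finite V] (hR : Good G R) (hg : g ∈ R)
    (hc : ∀ J, Good G J → J ⊆ R → g ∈ J → wt c J = 0) {J : Set (Sym2 V)} (hJ : Good G J)
    (hJR : J ⊆ R) : wt c J = 0 :=
  hJ.wt_eq_zero fun _ p hp hpJ => hR.wt_closed_trail_eq_zero hg hc p hp (hpJ.trans hJR)

end ThroughEdge

/-! ### Facets of polytopes containing the origin -/

section Polytope

open Module Submodule

variable {E : Type*} [AddCommGroup E] [Module ℝ E]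

/-- The points with `a x < b`, together with the hull of the generators on the hyperplane, form a
convex set containing every generator. -/
theorem face_convexHull_eq {X : Set E} {a : E →ₗ[ℝ] ℝ} {b : ℝ} (hX : ∀ x ∈ X, a x ≤ b) :
    {x | x ∈ convexHull ℝ X ∧ a x = b} = convexHull ℝ {x | x ∈ X ∧ a x = b} := by
  set Y := {x | x ∈ X ∧ a x = b} with hY
  have hYb : ∀ x ∈ convexHull ℝ Y, a x = b := fun x hx =>
    convexHull_min (fun y hy => hy.2) (convex_hyperplane a.isLinear b) hx
  refine Set.Subset.antisymm ?_ fun x hx => ⟨convexHull_mono (fun y hy => hy.1) hx, hYb x hx⟩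
  have hconv : Convex ℝ {x | a x < b ∨ x ∈ convexHull ℝ Y} := by
    intro x hx y hy s t hs ht hst
    have hle : ∀ z, a z < b ∨ z ∈ convexHull ℝ Y → a z ≤ b := fun z hz =>
      hz.elim le_of_lt fun h => (hYb z h).le
    have hx' := hle x hx
    have hy' := hle y hy
    change a (s • x + t • y) < b ∨ _
    rw [map_add, map_smul, map_smul, smul_eq_mul, smul_eq_mul]
    rcases hs.eq_or_lt with rfl | hs
    · obtain rfl : t = 1 := by linarith
      simpa using hy
    rcases ht.eq_or_lt with rfl | ht
    · obtain rfl : s = 1 := by linarith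
      simpa using hx
    have hb : b = s * b + t * b := by rw [← add_mul, hst, one_mul]
    rcases hx with hx | hx
    · left
      have := mul_lt_mul_of_pos_left hx hs
      have := mul_le_mul_of_nonneg_left hy' ht.le
      linarith
    rcases hy with hy | hy
    · left
      have := mul_lt_mul_of_pos_left hy ht
      have := mul_le_mul_of_nonneg_left hx' hs.le
      linarith
    exact .inr (convex_convexHull ℝ Y hx hy hs.le ht.le hst)
  rintro x ⟨hx, hxb⟩
  have : x ∈ {x | a x < b ∨ x ∈ convexHull ℝ Y} := convexHull_min (fun y hy => by
    rcases (hX y hy).lt_or_eq with h | h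
    · exact .inl h
    · exact .inr (subset_convexHull ℝ Y ⟨hy, h⟩)) hconv hx
  exact this.resolve_left hxb.not_lt

theorem affDim_convexHull {X : Set E} (hX : X.Nonempty) :
    affDim (convexHull ℝ X) = finrank ℝ (vectorSpan ℝ X) := by
  rw [affDim, if_pos hX.convexHull, affineSpan_convexHull, direction_affineSpan]

theorem vectorSpan_eq_span_of_zero_mem {X : Set E} (h0 : (0 : E) ∈ X) :
    vectorSpan ℝ X = span ℝ X := by
  rw [vectorSpan_eq_span_vsub_set_right ℝ h0]
  simp

/-- The hyperplane `a = b` misses the origin, so the span is the direct sum of the direction space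
and the line through one point of `Y`. -/
theorem finrank_vectorSpan_add_one [FiniteDimensional ℝ E] {Y : Set E} (hY : Y.Nonempty)
    {a : E →ₗ[ℝ] ℝ} {b : ℝ} (hb : b ≠ 0) (ha : ∀ y ∈ Y, a y = b) :
    finrank ℝ (vectorSpan ℝ Y) + 1 = finrank ℝ (span ℝ Y) := by
  obtain ⟨y₀, hy₀⟩ := hY
  have hker : vectorSpan ℝ Y ≤ LinearMap.ker a := by
    rw [vectorSpan_eq_span_vsub_set_right ℝ hy₀, span_le]
    rintro _ ⟨y, hy, rfl⟩
    simp [ha y hy, ha y₀ hy₀]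
  have hy₀0 : y₀ ≠ 0 := by
    rintro rfl
    exact hb (by simpa using (ha 0 hy₀).symm)
  have hsup : vectorSpan ℝ Y ⊔ span ℝ {y₀} = span ℝ Y := by
    refine le_antisymm (sup_le ?_ (span_mono (by simpa using hy₀))) (span_le.2 fun y hy => ?_)
    · rw [vectorSpan_eq_span_vsub_set_right ℝ hy₀, span_le]
      rintro _ ⟨y, hy, rfl⟩
      exact sub_mem (subset_span hy) (subset_span hy₀)
    · have h1 : y - y₀ ∈ vectorSpan ℝ Y := vsub_mem_vectorSpan ℝ hy hy₀
      have h2 : y₀ ∈ span ℝ {y₀} := mem_span_singleton_self y₀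
      have := add_mem (mem_sup_left (T := span ℝ {y₀}) h1) (mem_sup_right (S := vectorSpan ℝ Y) h2)
      simpa using this
  have hinf : vectorSpan ℝ Y ⊓ span ℝ {y₀} = ⊥ := by
    rw [eq_bot_iff]
    rintro x ⟨hx1, hx2⟩
    obtain ⟨t, rfl⟩ := mem_span_singleton.1 hx2
    have := hker hx1
    rw [LinearMap.mem_ker, map_smul, ha y₀ hy₀, smul_eq_mul] at this
    simp [(mul_eq_zero.1 this).resolve_right hb]
  have := finrank_sup_add_finrank_inf_eq (vectorSpan ℝ Y) (span ℝ {y₀})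
  rw [hsup, hinf, finrank_bot, finrank_span_singleton hy₀0] at this
  omega

/-- A valid inequality with non-zero right-hand side defines a facet of a polytope that has the
origin among its generators iff its roots span the same space as all generators. -/
theorem definesFacet_convexHull_iff [FiniteDimensional ℝ E] {X : Set E} (h0 : (0 : E) ∈ X)
    {a : E →ₗ[ℝ] ℝ} {b : ℝ} (hb : b ≠ 0) (hX : ∀ x ∈ X, a x ≤ b) :
    DefinesFacet (convexHull ℝ X) a b ↔ X ⊆ span ℝ {x | x ∈ X ∧ a x = b} := by
  have hvalid : ∀ x ∈ convexHull ℝ X, a x ≤ b := fun x hx =>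
    convexHull_min hX (convex_halfSpace_le a.isLinear b) hx
  rw [DefinesFacet, face_convexHull_eq hX, affDim_convexHull ⟨0, h0⟩,
    vectorSpan_eq_span_of_zero_mem h0]
  set Y := {x | x ∈ X ∧ a x = b} with hY
  have hle : span ℝ Y ≤ span ℝ X := span_mono fun y hy => hy.1
  have hdim : affDim (convexHull ℝ Y) = (finrank ℝ (span ℝ Y) : ℤ) - 1 := by
    -- Without roots, the convention `dim ∅ = -1` agrees with a span of rank zero.
    rcases Y.eq_empty_or_nonempty with h | h
    · rw [h, convexHull_empty, affDim, if_neg Set.not_nonempty_empty, span_empty, finrank_bot]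
      norm_num
    · rw [affDim_convexHull h, ← finrank_vectorSpan_add_one h hb fun y hy => hy.2]
      push_cast; ring
  rw [hdim]
  constructor
  · rintro ⟨-, h⟩
    have heq : span ℝ Y = span ℝ X := eq_of_le_of_finrank_eq hle (by omega)
    rw [heq]
    exact subset_span
  · intro h
    rw [le_antisymm hle (span_le.2 h)]
    exact ⟨hvalid, rfl⟩

theorem subset_span_iff_forall_linearMap {X Y : Set E} :
    X ⊆ span ℝ Y ↔ ∀ f : E →ₗ[ℝ] ℝ, (∀ y ∈ Y, f y = 0) → ∀ x ∈ X, f x = 0 := by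
  constructor
  · intro h f hf x hx
    have : span ℝ Y ≤ LinearMap.ker f := span_le.2 hf
    exact this (h hx)
  · intro h x hx
    by_contra hn
    obtain ⟨f, hfx, hf⟩ := exists_le_ker_of_notMem hn
    exact hfx (h f (fun y hy => hf (subset_span hy)) x hx)

end Polytope

/-! ### Good sets are the edge sets of 2-edge-connected subgraphs -/

section Subgraphs

variable {G : SimpleGraph V} {F : Set (Sym2 V)} {u v : V}

theorem joined_of_walk_deleteEdges {H : G.Subgraph} {D : Set (Sym2 H.verts)} {a b : H.verts}
    (p : (H.coe.deleteEdges D).Walk a b) :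
    Joined G (H.edgeSet \ Sym2.map (↑) '' D) (a : V) b := by
  induction p with
  | nil => exact .refl _
  | @cons a b c h p ih =>
    refine Joined.trans (Joined.of_mem (Set.sdiff_subset.trans H.edgeSet_subset) ?_) ih
    rw [SimpleGraph.deleteEdges_adj] at h
    refine ⟨by simpa using h.1, ?_⟩
    rintro ⟨e, he, heq⟩
    have : e = s(a, b) := Sym2.map.injective Subtype.val_injective (by simpa using heq)
    exact h.2 (this ▸ he)

theorem good_edgeSet {H : G.Subgraph} (h : H.coe.IsEdgeConnected 2) : Good G H.edgeSet where
  sub := H.edgeSet_subset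
  bridgeless u v huv := by
    have hadj : H.Adj u v := huv
    obtain ⟨p⟩ := isEdgeConnected_two.1 h s(⟨u, H.edge_vert hadj⟩, ⟨v, H.edge_vert hadj.symm⟩)
      ⟨u, H.edge_vert hadj⟩ ⟨v, H.edge_vert hadj.symm⟩
    simpa using joined_of_walk_deleteEdges p
  conn u hu v hv := by
    have hverts : ∀ x ∈ covered H.edgeSet, x ∈ H.verts := by
      rintro x ⟨e, he, hx⟩
      exact H.mem_verts_of_mem_edge he hx
    obtain ⟨p⟩ := h.preconnected (by simp) ⟨u, hverts u hu⟩ ⟨v, hverts v hv⟩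
    have q := joined_of_walk_deleteEdges (D := ∅) (p.mapLe (by simp))
    simpa using q

/-- Each use of the deleted edge is replaced by a detour around it. -/
theorem Good.joined_diff (h : Good G F) (e : Sym2 V) (hj : Joined G F u v) :
    Joined G (F \ {e}) u v := by
  obtain ⟨p, hp⟩ := hj
  induction p with
  | nil => exact .refl _
  | @cons a b c hadj p ih =>
    refine Joined.trans ?_ (ih fun e he => hp e (by simp [he]))
    have hab : s(a, b) ∈ F := hp _ (by simp)
    by_cases he : s(a, b) = e
    · exact he ▸ h.bridgeless a b hab
    · exact ⟨hadj.toWalk, by simpa using ⟨hab, he⟩⟩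

/-- The subgraph formed by an edge set and its end vertices. -/
def subgraphOf (hF : F ⊆ G.edgeSet) : G.Subgraph where
  verts := covered F
  Adj u v := s(u, v) ∈ F
  adj_sub h := hF h
  edge_vert h := mem_covered_left h
  symm := ⟨fun _ _ h => by rwa [Sym2.eq_swap]⟩

theorem edgeSet_subgraphOf (hF : F ⊆ G.edgeSet) : (subgraphOf hF).edgeSet = F := by
  ext e
  induction e with
  | h a b => exact Iff.rfl

theorem Good.isEdgeConnected (h : Good G F) : (subgraphOf h.sub).coe.IsEdgeConnected 2 := by
  rw [isEdgeConnected_two]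
  rintro e ⟨a, ha⟩ ⟨b, hb⟩
  obtain ⟨p, hp⟩ := h.joined_diff (e.map (↑)) (h.conn a ha b hb)
  induction p with
  | nil => exact .refl _
  | @cons a c b hadj p ih =>
    have hac := hp s(a, c) (by simp)
    have hc : c ∈ covered F := mem_covered_right hac.1
    refine Reachable.trans (Adj.reachable ?_) (ih hc hb fun e he => hp e (by simp [he]))
    rw [SimpleGraph.deleteEdges_adj]
    refine ⟨hac.1, fun he => hac.2 ?_⟩
    rw [Set.mem_singleton_iff] at he
    rw [← he]
    rfl

/-- This allows vertex sets to be forgotten: the empty graph and single vertices all give the good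
set `∅`. -/
theorem exists_subgraph_iff_good :
    (∃ H : G.Subgraph, H.coe.IsEdgeConnected 2 ∧ H.edgeSet = F) ↔ Good G F :=
  ⟨fun ⟨_, h, hF⟩ => hF ▸ good_edgeSet h,
    fun h => ⟨_, h.isEdgeConnected, edgeSet_subgraphOf h.sub⟩⟩

theorem good_edgeSet_self (hG : G.IsEdgeConnected 2) : Good G G.edgeSet where
  sub := subset_rfl
  bridgeless u v huv := by
    obtain ⟨p⟩ := isEdgeConnected_two.1 hG s(u, v) u v
    have hp : ∀ e ∈ p.edges, e ∈ G.edgeSet \ {s(u, v)} := fun e he => by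
      simpa using p.edges_subset_edgeSet he
    exact ⟨p.transfer G fun e he => (hp e he).1, by simpa using hp⟩
  conn u _ v _ := by
    obtain ⟨p⟩ := hG.preconnected (by simp) u v
    exact ⟨p, p.edges_subset_edgeSet⟩

/-! ### Induced subgraphs. -/

theorem mk_mem_edgeSet_ind {W : Set V} :
    s(u, v) ∈ (ind G W).edgeSet ↔ u ∈ W ∧ v ∈ W ∧ G.Adj u v := by
  simp [ind]

theorem mem_of_mem_edgeSet_ind {W : Set V} {e : Sym2 V} (he : e ∈ (ind G W).edgeSet)
    (hv : v ∈ e) : v ∈ W := by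
  induction e with
  | h a b =>
    rw [mk_mem_edgeSet_ind] at he
    rcases Sym2.mem_iff.1 hv with rfl | rfl
    · exact he.1
    · exact he.2.1

theorem disjoint_edgeSet_ind_cut (W : Set V) : Disjoint (ind G W).edgeSet (cut G W) := by
  rw [Set.disjoint_left]
  rintro e he ⟨-, a, -, b, hb, rfl⟩
  exact hb (mk_mem_edgeSet_ind.1 he).2.1

theorem covered_edgeSet_ind_subset (W : Set V) : covered (ind G W).edgeSet ⊆ W :=
  fun _ ⟨_, he, hv⟩ => mem_of_mem_edgeSet_ind he hv

/-- A good set that misses a cut and covers a vertex of one side lies in that side. -/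
theorem Good.subset_edgeSet_ind {W : Set V} (h : Good G F) (hF : Disjoint F (cut G W))
    (hv : v ∈ covered F) (hvW : v ∈ W) : F ⊆ (ind G W).edgeSet := by
  have hcov : ∀ x ∈ covered F, x ∈ W := by
    intro x hx
    by_contra hxW
    obtain ⟨e, he, hc⟩ := h.exists_mem_cut hv hx hvW hxW
    exact Set.disjoint_left.1 hF he hc
  intro e he
  induction e with
  | h a b =>
    exact mk_mem_edgeSet_ind.2 ⟨hcov a (mem_covered_left he), hcov b (mem_covered_right he),
      h.sub he⟩

end Subgraphs

/-! ### The facet condition in terms of weights -/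

section Roots

variable {G : SimpleGraph V} {S : Set V} {e₁ e₂ : Sym2 V} {F : Set (Sym2 V)}

/-- The good sets that satisfy the connectivity cut inequality with equality. -/
def IsRoot (G : SimpleGraph V) (S : Set V) (e₁ e₂ : Sym2 V) (F : Set (Sym2 V)) : Prop :=
  Good G F ∧ ((e₁ ∈ F ∧ e₂ ∈ F ∧ (F ∩ cut G S).ncard = 2) ∨
    ((e₁ ∈ F ∨ e₂ ∈ F) ∧ Disjoint F (cut G S)))

/-- The roots determine the linear hull of the polytope. -/
def RootsDetermine (G : SimpleGraph V) (S : Set V) (e₁ e₂ : Sym2 V) : Prop :=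
  ∀ c : Sym2 V → ℝ, (∀ F, IsRoot G S e₁ e₂ F → wt c F = 0) → ∀ F, Good G F → wt c F = 0

theorem IsRoot.symm (h : IsRoot G S e₁ e₂ F) : IsRoot G Sᶜ e₂ e₁ F := by
  unfold IsRoot at *
  rw [cut_compl]
  tauto

theorem RootsDetermine.symm (h : RootsDetermine G S e₁ e₂) : RootsDetermine G Sᶜ e₂ e₁ :=
  fun c hc => h c fun F hF => hc F hF.symm

variable [Finite V]

open Classical in
theorem linearMap_incVec (f : (G.edgeSet → ℝ) →ₗ[ℝ] ℝ) (H : G.Subgraph) :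
    f (incVec H) =
      wt (fun e => if h : e ∈ G.edgeSet then f (Pi.single ⟨e, h⟩ 1) else 0) H.edgeSet := by
  have := Fintype.ofFinite V
  set c : Sym2 V → ℝ := fun e => if h : e ∈ G.edgeSet then f (Pi.single ⟨e, h⟩ 1) else 0 with hc
  have h1 : wt c H.edgeSet = ∑ᶠ e : G.edgeSet, H.edgeSet.indicator c e := by
    rw [finsum_subtype_eq_finsum_cond (f := H.edgeSet.indicator c) (p := (· ∈ G.edgeSet))]
    change _ = wt (H.edgeSet.indicator c) G.edgeSet
    rw [wt_indicator, Set.inter_eq_right.2 H.edgeSet_subset]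
  rw [h1, finsum_eq_sum_of_fintype, LinearMap.pi_apply_eq_sum_univ]
  refine Finset.sum_congr rfl fun e _ => ?_
  have h2 : f (Pi.single e 1) = c e := by simp [hc]
  by_cases he : (e : Sym2 V) ∈ H.edgeSet
  · simp only [incVec, Set.indicator, Set.mem_ofPred_eq, he, if_true, Pi.one_apply, one_smul]
    rw [← h2]
    congr 1
    ext j
    simp [Pi.single_apply, eq_comm]
  · simp [incVec, Set.indicator, he]

open Classical in
theorem edgeSum_incVec (D : Set (Sym2 V)) (H : G.Subgraph) :
    edgeSum G D (incVec H) = (H.edgeSet ∩ D).ncard := by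
  have := Fintype.ofFinite V
  rw [linearMap_incVec, ← wt_one, ← wt_indicator, wt, wt]
  refine finsum_mem_congr rfl fun e he => ?_
  rw [dif_pos (H.edgeSet_subset he), edgeSum, finsum_eq_sum_of_fintype, LinearMap.sum_apply,
    Finset.sum_eq_single ⟨e, H.edgeSet_subset he⟩]
  · rw [finsum_eq_if]
    by_cases hD : e ∈ D <;> simp [hD]
  · intro b _ hb
    rw [finsum_eq_if]
    split_ifs
    · simp [hb]
    · simp
  · simp

open Classical in
theorem connectivityCutForm_incVec (S : Set V) (e₁ e₂ : G.edgeSet) (H : G.Subgraph) :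
    connectivityCutForm G S e₁ e₂ (incVec H) =
      2 * (if (e₁ : Sym2 V) ∈ H.edgeSet then 1 else 0) - (H.edgeSet ∩ cut G S).ncard +
        2 * (if (e₂ : Sym2 V) ∈ H.edgeSet then 1 else 0) := by
  rw [connectivityCutForm, LinearMap.add_apply, LinearMap.sub_apply, edgeSum_incVec]
  simp [incVec, Set.indicator]

/-- This is the only case in which validity of the inequality is not immediate: connectivity gives
one cut edge, bridgelessness a second. -/
theorem Good.two_le_ncard_cut (h : Good G F) (he₁ : e₁ ∈ (ind G S).edgeSet)
    (he₂ : e₂ ∈ (ind G Sᶜ).edgeSet) (h₁ : e₁ ∈ F) (h₂ : e₂ ∈ F) :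
    2 ≤ (F ∩ cut G S).ncard := by
  induction e₁ with
  | h a b =>
  induction e₂ with
  | h a' b' =>
  obtain ⟨d, hd, hdc⟩ := h.exists_mem_cut (mem_covered_left h₁) (mem_covered_left h₂)
    (mk_mem_edgeSet_ind.1 he₁).1 (mk_mem_edgeSet_ind.1 he₂).1
  obtain ⟨d', hd', hne, hdc'⟩ := h.exists_ne_mem_cut hd hdc
  exact (Set.one_lt_ncard (Set.toFinite _)).2 ⟨d, ⟨hd, hdc⟩, d', ⟨hd', hdc'⟩, hne.symm⟩

/-- Linear functionals on `ℝ^E` are edge weights, so the span criterion for facets becomes a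
statement about weights; equality in the inequality is read off from whether `e₁` and `e₂` are used.
-/
theorem definesFacet_iff {e₁ e₂ : G.edgeSet} (he₁ : (e₁ : Sym2 V) ∈ (ind G S).edgeSet)
    (he₂ : (e₂ : Sym2 V) ∈ (ind G Sᶜ).edgeSet) :
    DefinesFacet (TECSP G) (connectivityCutForm G S e₁ e₂) 2 ↔ RootsDetermine G S e₁ e₂ := by
  classical
  have := Fintype.ofFinite V
  have hval : ∀ H : G.Subgraph, Good G H.edgeSet →
      connectivityCutForm G S e₁ e₂ (incVec H) ≤ 2 ∧
      (connectivityCutForm G S e₁ e₂ (incVec H) = 2 ↔ IsRoot G S e₁ e₂ H.edgeSet) := by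
    intro H hH
    rw [connectivityCutForm_incVec, IsRoot]
    have h2 := hH.two_le_ncard_cut he₁ he₂
    have hdisj : Disjoint H.edgeSet (cut G S) ↔ (H.edgeSet ∩ cut G S).ncard = 0 := by
      rw [Set.ncard_eq_zero, Set.disjoint_iff_inter_eq_empty]
    rw [hdisj]
    generalize (H.edgeSet ∩ cut G S).ncard = n at *
    by_cases h₁ : (e₁ : Sym2 V) ∈ H.edgeSet <;> by_cases h₂ : (e₂ : Sym2 V) ∈ H.edgeSet
    · have hn : (2 : ℝ) ≤ n := by exact_mod_cast h2 h₁ h₂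
      simp only [h₁, h₂, hH, if_true, true_and, true_or]
      have : ((n : ℝ) = 2 ↔ n = 2) := by exact_mod_cast Iff.rfl
      refine ⟨by linarith, ?_⟩
      constructor
      · intro h; exact .inl (this.1 (by linarith))
      · rintro (h | h)
        · rw [this.2 h]; norm_num
        · have := h2 h₁ h₂; omega
    all_goals
      have hn : (0 : ℝ) ≤ n := by positivity
      have : ((n : ℝ) = 0 ↔ n = 0) := by exact_mod_cast Iff.rfl
      simp only [h₁, h₂, hH, if_true, if_false, true_and, or_true, false_and, and_false,
        false_or, or_false]
      refine ⟨by linarith, ?_⟩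
      -- The second alternative is for a subgraph with neither edge: its left-hand side is at most
      -- 0, never 2.
      first
        | exact ⟨fun h => this.1 (by linarith), fun h => by rw [this.2 h]; norm_num⟩
        | exact ⟨fun h => by linarith, fun h => h.elim⟩
  rw [TECSP, definesFacet_convexHull_iff _ two_ne_zero, subset_span_iff_forall_linearMap]
  · constructor
    · intro h c hc F hF
      obtain ⟨H, hH, rfl⟩ := exists_subgraph_iff_good.2 hF
      let f : (G.edgeSet → ℝ) →ₗ[ℝ] ℝ := ∑ e : G.edgeSet, c e • LinearMap.proj e
      have hf : ∀ H : G.Subgraph, f (incVec H) = wt c H.edgeSet := by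
        intro H
        rw [linearMap_incVec]
        refine finsum_mem_congr rfl fun e he => ?_
        rw [dif_pos (H.edgeSet_subset he), LinearMap.sum_apply,
          Finset.sum_eq_single ⟨e, H.edgeSet_subset he⟩]
        · simp
        · intro b _ hb; simp [hb]
        · simp
      rw [← hf]
      refine h f ?_ _ ⟨H, hH, rfl⟩
      rintro _ ⟨⟨H', hH', rfl⟩, heq⟩
      rw [hf]
      exact hc _ ((hval H' (good_edgeSet hH')).2.1 heq)
    · rintro h f hf _ ⟨H, hH, rfl⟩
      rw [linearMap_incVec]
      refine h _ (fun F hF => ?_) _ (good_edgeSet hH)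
      obtain ⟨H', hH', rfl⟩ := exists_subgraph_iff_good.2 hF.1
      rw [← linearMap_incVec]
      exact hf _ ⟨⟨H', hH', rfl⟩, (hval H' (good_edgeSet hH')).2.2 hF⟩
  · rintro _ ⟨H, hH, rfl⟩
    exact (hval H (good_edgeSet hH)).1
  · obtain ⟨H, hH, hE⟩ := exists_subgraph_iff_good.2 (good_empty (G := G))
    refine ⟨H, hH, ?_⟩
    ext e
    simp [incVec, hE]

end Roots

/-! ### Sides of bridges -/

section Sides

variable {G : SimpleGraph V} {S W X : Set V} {e e' f : Sym2 V} {F : Set (Sym2 V)} {r u v : V}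

theorem reachable_ind_deleteEdges_iff :
    ((ind G W).deleteEdges {f}).spanningCoe.Reachable u v ↔
      Joined G ((ind G W).edgeSet \ {f}) u v := by
  have hsub : (ind G W).edgeSet \ {f} ⊆ G.edgeSet :=
    Set.sdiff_subset.trans (ind G W).edgeSet_subset
  rw [joined_iff_reachable hsub]
  suffices h : ((ind G W).deleteEdges {f}).spanningCoe =
      fromEdgeSet ((ind G W).edgeSet \ {f}) by rw [h]
  ext a b
  simp only [Subgraph.spanningCoe_adj, Subgraph.deleteEdges_adj, fromEdgeSet_adj, Set.mem_sdiff,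
    Subgraph.mem_edgeSet]
  exact ⟨fun h => ⟨h, h.1.ne⟩, fun h => h.1⟩

theorem isBridgeOf_ind_iff :
    IsBridgeOf (ind G W) s(u, v) ↔
      s(u, v) ∈ (ind G W).edgeSet ∧ ¬ Joined G ((ind G W).edgeSet \ {s(u, v)}) u v := by
  rw [IsBridgeOf, isBridge_iff, ← reachable_ind_deleteEdges_iff,
    Subgraph.deleteEdges_spanningCoe_eq]

theorem Joined.mem_of_edgeSet_ind (hF : F ⊆ (ind G W).edgeSet) (h : Joined G F u v)
    (hu : u ∈ W) : v ∈ W := by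
  by_contra hv
  obtain ⟨e, he, hc⟩ := h.exists_mem_cut hu hv
  exact Set.disjoint_left.1 (disjoint_edgeSet_ind_cut W) (hF he) hc

/-- The induced subgraph `G[W]` is connected. -/
def ConnectedOn (G : SimpleGraph V) (W : Set V) : Prop :=
  ∀ u ∈ W, ∀ v ∈ W, Joined G (ind G W).edgeSet u v

/-- `X` is one of the two sides of the bridge `f` of `G[W]`. -/
def IsSide (G : SimpleGraph V) (W : Set V) (f : Sym2 V) (X : Set V) : Prop :=
  X ⊆ W ∧ (ind G W).edgeSet ∩ cut G X = {f}

/-- The vertices of `G[W]` joined to `r` after deletion of `f`. -/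
def nearSide (G : SimpleGraph V) (W : Set V) (f : Sym2 V) (r : V) : Set V :=
  {w | w ∈ W ∧ Joined G ((ind G W).edgeSet \ {f}) w r}

theorem isSide_nearSide (hW : ConnectedOn G W) (hf : IsBridgeOf (ind G W) f) (hr : r ∈ W) :
    IsSide G W f (nearSide G W f r) := by
  induction f with
  | h a b =>
  obtain ⟨hab, hnj⟩ := isBridgeOf_ind_iff.1 hf
  obtain ⟨haW, hbW, hadj⟩ := mk_mem_edgeSet_ind.1 hab
  refine ⟨fun x hx => hx.1, ?_⟩
  have hsub : (ind G W).edgeSet \ {s(a, b)} ⊆ G.edgeSet :=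
    Set.sdiff_subset.trans (ind G W).edgeSet_subset
  refine Set.Subset.antisymm ?_ ?_
  · rintro e ⟨he, -, x, hx, y, hy, rfl⟩
    by_contra hne
    obtain ⟨-, hyW, -⟩ := mk_mem_edgeSet_ind.1 he
    exact hy ⟨hyW, (Joined.of_mem hsub ⟨he, hne⟩).symm.trans hx.2⟩
  · rintro e rfl
    refine ⟨hab, ?_⟩
    have hreach : Joined G ((ind G W).edgeSet \ {s(a, b)}) r a ∨
        Joined G ((ind G W).edgeSet \ {s(a, b)}) r b := by
      obtain ⟨p, hp⟩ := hW r hr a haW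
      -- Up to the first end of the bridge that it meets, the walk cannot use the bridge.
      obtain ⟨z, hz, q, t, rfl, -, hq, -⟩ :=
        exists_first_visit p (A := {a, b}) ⟨a, by simp, by simp⟩
      have hj : Joined G ((ind G W).edgeSet \ {s(a, b)}) r z := by
        refine ⟨q, fun e he => ⟨hp e (by simp [he]), ?_⟩⟩
        rintro rfl
        obtain ⟨x, hx, hxA⟩ := hq _ he
        exact hxA (by simpa using hx)
      rcases hz with rfl | rfl
      · exact .inl hj
      · exact .inr hj
    rw [mk_mem_cut_iff]
    refine ⟨hadj, ?_⟩
    rcases hreach with h | h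
    · exact .inl ⟨⟨haW, h.symm⟩, fun hb => hnj (h.symm.trans hb.2.symm)⟩
    · exact .inr ⟨fun ha => hnj (ha.2.trans h), ⟨hbW, h.symm⟩⟩

theorem IsSide.mem_cut (h : IsSide G W f X) : f ∈ cut G X := by
  have : f ∈ (ind G W).edgeSet ∩ cut G X := by rw [h.2]; rfl
  exact this.2

theorem IsSide.mem_ind (h : IsSide G W f X) : f ∈ (ind G W).edgeSet := by
  have : f ∈ (ind G W).edgeSet ∩ cut G X := by rw [h.2]; rfl
  exact this.1

theorem IsSide.diff (h : IsSide G W f X) : IsSide G W f (W \ X) := by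
  refine ⟨Set.sdiff_subset, ?_⟩
  rw [← h.2]
  ext e
  induction e with
  | h a b =>
    simp only [Set.mem_inter_iff, mk_mem_edgeSet_ind, mk_mem_cut_iff, Set.mem_sdiff]
    tauto

/-- An edge leaving a side of `f` is `f` or leaves `W`. -/
theorem IsSide.eq_or_mem_cut (h : IsSide G W f X) (he : e ∈ cut G X) :
    e = f ∨ e ∈ cut G W := by
  by_cases hc : e ∈ cut G W
  · exact .inr hc
  · left
    have : e ∈ (ind G W).edgeSet ∩ cut G X := by
      refine ⟨?_, he⟩
      obtain ⟨hadj, a, ha, b, hb, rfl⟩ := he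
      refine mk_mem_edgeSet_ind.2 ⟨h.1 ha, ?_, hadj⟩
      by_contra hbW
      exact hc ⟨hadj, a, h.1 ha, b, hbW, rfl⟩
    rwa [h.2] at this

theorem IsSide.cut_eq (h : IsSide G W f X) : cut G X = insert f (cut G W ∩ cut G X) := by
  ext e
  constructor
  · intro he
    rcases h.eq_or_mem_cut he with rfl | hc
    · exact .inl rfl
    · exact .inr ⟨hc, he⟩
  · rintro (rfl | he)
    · exact h.mem_cut
    · exact he.2

theorem IsSide.disjoint_cut (h : IsSide G W f X) :
    Disjoint (cut G W ∩ cut G X) (cut G W ∩ cut G (W \ X)) := by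
  have hXW := h.1
  rw [Set.disjoint_left]
  intro e
  induction e with
  | h a b =>
    simp only [Set.mem_inter_iff, mk_mem_cut_iff, Set.mem_sdiff]
    have := @hXW a
    have := @hXW b
    tauto

theorem IsSide.union_cut (h : IsSide G W f X) :
    cut G W ∩ cut G X ∪ cut G W ∩ cut G (W \ X) = cut G W := by
  have hXW := h.1
  ext e
  induction e with
  | h a b =>
    simp only [Set.mem_union, Set.mem_inter_iff, mk_mem_cut_iff, Set.mem_sdiff]
    have := @hXW a
    have := @hXW b
    tauto

/-- The side of `f` in `G[W]` away from `e`. -/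
def farSide (G : SimpleGraph V) (W : Set V) (e f : Sym2 V) : Set V :=
  {w | w ∈ W ∧ ∀ u ∈ e, ¬ Joined G ((ind G W).edgeSet \ {f}) w u}

theorem farSide_mk (huv : s(u, v) ∈ (ind G W).edgeSet) (hne : s(u, v) ≠ f) :
    farSide G W s(u, v) f = W \ nearSide G W f u := by
  have hj : Joined G ((ind G W).edgeSet \ {f}) u v :=
    Joined.of_mem (Set.sdiff_subset.trans (ind G W).edgeSet_subset) ⟨huv, hne⟩
  ext w
  simp only [farSide, nearSide, Set.mem_ofPred_eq, Set.mem_sdiff, Sym2.mem_iff, forall_eq_or_imp,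
    forall_eq, not_and]
  refine and_congr_right fun hw => ⟨fun h _ => h.1, fun h => ⟨h hw, fun h' => ?_⟩⟩
  exact h hw (h'.trans hj.symm)

theorem isSide_farSide (hW : ConnectedOn G W) (hf : IsBridgeOf (ind G W) f)
    (he : e ∈ (ind G W).edgeSet) (hne : e ≠ f) : IsSide G W f (farSide G W e f) := by
  induction e with
  | h u v =>
    rw [farSide_mk he hne]
    exact (isSide_nearSide hW hf (mk_mem_edgeSet_ind.1 he).1).diff

theorem notMem_farSide (hu : u ∈ e) : u ∉ farSide G W e f := fun h => h.2 u hu (.refl u)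

theorem bridgeCut_comm : bridgeCut G W e e' f = bridgeCut G W e' e f := by
  simp only [bridgeCut, or_comm]

/-- A component of `G[W] - f` that starts in `W` stays in `W`, so avoiding `e'` is automatic. -/
theorem bridgeCut_eq (he' : e' ∈ (ind G Wᶜ).edgeSet) :
    bridgeCut G W e e' f = cut G W ∩ cut G (farSide G W e f) := by
  ext d
  simp only [bridgeCut, Set.mem_ofPred_eq, Set.mem_inter_iff, reachable_ind_deleteEdges_iff]
  refine and_congr_right fun hd => ?_
  constructor
  · rintro ⟨w, hw, hwd, h⟩
    have hfar : w ∈ farSide G W e f := ⟨hw, fun u hu => h u (.inl hu)⟩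
    obtain ⟨hadj, a, ha, b, hb, rfl⟩ := hd
    have hwa : w = a := by
      rcases Sym2.mem_iff.1 hwd with h | h
      · exact h
      · exact absurd (h ▸ hw) hb
    subst hwa
    exact ⟨hadj, w, hfar, b, fun h => hb h.1, rfl⟩
  · rintro ⟨-, w, hw, b, -, rfl⟩
    refine ⟨w, hw.1, by simp, ?_⟩
    rintro u (hu | hu)
    · exact hw.2 u hu
    · exact fun hj => mem_of_mem_edgeSet_ind he' hu (hj.mem_of_edgeSet_ind Set.sdiff_subset hw.1)

/-- Both sides of an inclusionwise minimal cut of a connected graph induce connected subgraphs. -/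
theorem connectedOn_of_minimal (hG : G.Preconnected) (hS : S ≠ Set.univ)
    (hmin : Minimal (IsCut G) (cut G S)) : ConnectedOn G S := by
  intro u hu v hv
  by_contra hnj
  set A := {w | w ∈ S ∧ Joined G (ind G S).edgeSet u w} with hA
  have hAS : A ⊆ S := fun w hw => hw.1
  have huA : u ∈ A := ⟨hu, .refl u⟩
  have hvA : v ∉ A := fun h => hnj h.2
  have hclosed : ∀ a ∈ A, ∀ b ∈ S, G.Adj a b → b ∈ A := fun a ha b hb hab =>
    ⟨hb, ha.2.trans (Joined.of_mem (ind G S).edgeSet_subset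
      (mk_mem_edgeSet_ind.2 ⟨ha.1, hb, hab⟩))⟩
  have hsub : cut G A ⊆ cut G S := by
    rintro e ⟨hadj, a, ha, b, hb, rfl⟩
    exact ⟨hadj, a, hAS ha, b, fun hbS => hb (hclosed a ha b hbS hadj), rfl⟩
  have hle : cut G S ⊆ cut G A := hmin.2
    ⟨A, ⟨u, huA⟩, fun h => hvA (h ▸ Set.mem_univ v), rfl⟩ hsub
  -- An edge leaving `S \ A` cannot enter `A`, so it leaves `S`: it is in `δ(S)` but not in `δ(A)`,
  -- contrary to minimality.
  obtain ⟨t, ht⟩ := (Set.ne_univ_iff_exists_notMem S).1 hS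
  obtain ⟨p⟩ := hG v t
  obtain ⟨d, -, hd1, hd2⟩ := p.exists_boundary_dart (S \ A) ⟨hv, hvA⟩ (fun h => ht h.1)
  have hadj := d.adj
  by_cases hd2S : d.snd ∈ S
  · have hd2A : d.snd ∈ A := by
      by_contra h
      exact hd2 ⟨hd2S, h⟩
    exact hd1.2 (hclosed _ hd2A _ hd1.1 hadj.symm)
  · have h1 : s(d.fst, d.snd) ∈ cut G S := ⟨hadj, _, hd1.1, _, hd2S, rfl⟩
    have h2 := hle h1
    rw [mk_mem_cut_iff] at h2
    have := hd1.2
    have := @hAS d.snd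
    tauto

end Sides

/-! ### Necessity, and sufficiency for a two-edge cut -/

section BridgeEdge

variable {G : SimpleGraph V} {S X : Set V} {e₁ e₂ f : Sym2 V} {F : Set (Sym2 V)} [Finite V]

-- The two cut edges of a crossing root are shared between the sides `X` and `S \ X`. If `f ∈ F`,
-- bridgelessness gives each side at least one. If `f ∉ F`, a cut edge at `X` would force the second
-- one at `X` too, leaving none to connect `e₁`, outside `X`, with `e₂`.
open Classical in
theorem IsRoot.ncard_inter_side (h : IsRoot G S e₁ e₂ F) (he₂ : e₂ ∈ (ind G Sᶜ).edgeSet)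
    (he₁ : e₁ ∈ (ind G S).edgeSet) (hX : IsSide G S f X) (hf : e₁ = f ∨ ∃ v ∈ e₁, v ∉ X) :
    (F ∩ (cut G S ∩ cut G X)).ncard = if f ∈ F then 1 else 0 := by
  obtain ⟨hF, ⟨h₁, h₂, h2⟩ | ⟨-, hdisj⟩⟩ := h
  · set A := F ∩ (cut G S ∩ cut G X)
    set B := F ∩ (cut G S ∩ cut G (S \ X))
    have hAB : A.ncard + B.ncard = 2 := by
      rw [← Set.ncard_union_eq (hX.disjoint_cut.mono Set.inter_subset_right Set.inter_subset_right),
        ← Set.inter_union_distrib_left, hX.union_cut, h2]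
    split_ifs with hfF
    · obtain ⟨d, hd, hdf, hdX⟩ := hF.exists_ne_mem_cut hfF hX.mem_cut
      obtain ⟨d', hd', hdf', hdX'⟩ := hF.exists_ne_mem_cut hfF hX.diff.mem_cut
      have h1 : 0 < A.ncard := (Set.ncard_pos).2
        ⟨d, hd, (hX.eq_or_mem_cut hdX).resolve_left hdf, hdX⟩
      have h2 : 0 < B.ncard := (Set.ncard_pos).2
        ⟨d', hd', (hX.diff.eq_or_mem_cut hdX').resolve_left hdf', hdX'⟩
      omega
    · by_contra hA0
      obtain ⟨d, hdF, hdS, hdX⟩ := (Set.ncard_pos (s := A)).1 (by omega)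
      obtain ⟨d', hd', hne, hdX'⟩ := hF.exists_ne_mem_cut hdF hdX
      have hd'S := (hX.eq_or_mem_cut hdX').resolve_left (fun h => hfF (h ▸ hd'))
      have hA2 : 1 < A.ncard := (Set.one_lt_ncard (Set.toFinite _)).2
        ⟨d, ⟨hdF, hdS, hdX⟩, d', ⟨hd', hd'S, hdX'⟩, hne.symm⟩
      obtain ⟨v, hv, hvX⟩ := hf.resolve_left (fun h => hfF (h ▸ h₁))
      induction e₂ with
      | h a b =>
      obtain ⟨d₀, hd₀, hc₀⟩ := hF.exists_mem_cut (X := S \ X) (u := v) (v := a) ⟨_, h₁, hv⟩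
        (mem_covered_left h₂) ⟨mem_of_mem_edgeSet_ind he₁ hv, hvX⟩
        (fun h => (mk_mem_edgeSet_ind.1 he₂).1 h.1)
      have h3 : 0 < B.ncard := (Set.ncard_pos).2
        ⟨d₀, hd₀, (hX.diff.eq_or_mem_cut hc₀).resolve_left (fun h => hfF (h ▸ hd₀)), hc₀⟩
      omega
  · have hfF : f ∉ F := by
      intro hfF
      obtain ⟨d, hd, hdf, hdX⟩ := hF.exists_ne_mem_cut hfF hX.mem_cut
      exact Set.disjoint_left.1 hdisj hd ((hX.eq_or_mem_cut hdX).resolve_left hdf)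
    rw [if_neg hfF, Set.ncard_eq_zero, ← Set.inter_assoc, hdisj.inter_eq, Set.empty_inter]

/-- If the roots determine the polytope, each relevant side of a bridge meets the cut once. -/
theorem RootsDetermine.ncard_side (h : RootsDetermine G S e₁ e₂) (hG : Good G G.edgeSet)
    (he₁ : e₁ ∈ (ind G S).edgeSet) (he₂ : e₂ ∈ (ind G Sᶜ).edgeSet)
    (hX : IsSide G S f X) (hf : e₁ = f ∨ ∃ v ∈ e₁, v ∉ X) :
    (cut G S ∩ cut G X).ncard = 1 := by
  classical
  have hwt : ∀ F : Set (Sym2 V),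
      wt ((cut G S ∩ cut G X).indicator 1 - ({f} : Set _).indicator 1) F =
      (F ∩ (cut G S ∩ cut G X)).ncard - (if f ∈ F then 1 else 0) := by
    intro F
    have h1 : wt ((cut G S ∩ cut G X).indicator 1 - ({f} : Set _).indicator 1) F =
        wt ((cut G S ∩ cut G X).indicator 1) F - wt (({f} : Set _).indicator 1) F :=
      finsum_mem_sub_distrib _ _ (Set.toFinite F)
    rw [h1, wt_indicator, wt_indicator, wt_one, wt_one]
    congr 1
    split_ifs with hfF
    · rw [Set.inter_eq_right.2 (by simpa using hfF)]; simp
    · rw [Set.inter_singleton_eq_empty.2 hfF]; simp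
  -- The weight counts edges of `δ(S) ∩ δ(X)` minus `f`; it vanishes on roots and is now evaluated
  -- on the whole graph.
  have key := h _ (fun F hF => by
    rw [hwt, hF.ncard_inter_side he₂ he₁ hX hf]
    split_ifs <;> simp) G.edgeSet hG
  rw [hwt, if_pos ((ind G S).edgeSet_subset hX.mem_ind),
    Set.inter_eq_right.2 (fun e he => he.1.1)] at key
  have : ((cut G S ∩ cut G X).ncard : ℝ) = 1 := by linarith
  exact_mod_cast this

theorem RootsDetermine.ncard_cut_eq_two (h : RootsDetermine G S e₁ e₂) (hG : Good G G.edgeSet)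
    (hS : ConnectedOn G S) (he₁ : e₁ ∈ (ind G S).edgeSet) (he₂ : e₂ ∈ (ind G Sᶜ).edgeSet)
    (hb : IsBridgeOf (ind G S) e₁) : (cut G S).ncard = 2 := by
  obtain ⟨r, hr⟩ : S.Nonempty := by
    induction e₁ with
    | h a b => exact ⟨a, (mk_mem_edgeSet_ind.1 he₁).1⟩
  have hX := isSide_nearSide hS hb hr
  have h1 := h.ncard_side hG he₁ he₂ hX (.inl rfl)
  have h2 := h.ncard_side hG he₁ he₂ hX.diff (.inl rfl)
  rw [← hX.union_cut, Set.ncard_union_eq hX.disjoint_cut, h1, h2]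

theorem RootsDetermine.ncard_bridgeCut (h : RootsDetermine G S e₁ e₂) (hG : Good G G.edgeSet)
    (hS : ConnectedOn G S) (he₁ : e₁ ∈ (ind G S).edgeSet) (he₂ : e₂ ∈ (ind G Sᶜ).edgeSet)
    (hb : ¬ IsBridgeOf (ind G S) e₁) (hf : IsBridgeOf (ind G S) f) :
    (bridgeCut G S e₁ e₂ f).ncard = 1 := by
  have hne : e₁ ≠ f := fun h => hb (h ▸ hf)
  rw [bridgeCut_eq he₂]
  refine h.ncard_side hG he₁ he₂ (isSide_farSide hS hf he₁ hne) (.inr ?_)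
  induction e₁ with
  | h a b => exact ⟨a, by simp, notMem_farSide (by simp)⟩

/-- If `e₁` is a bridge of `G[S]` and the cut has two edges, all good sets through `e₂` are
roots. -/
theorem rootsDetermine_of_isBridgeOf (hG : Good G G.edgeSet)
    (hS : ConnectedOn G S) (he₁ : e₁ ∈ (ind G S).edgeSet) (he₂ : e₂ ∈ (ind G Sᶜ).edgeSet)
    (hb : IsBridgeOf (ind G S) e₁) (h2 : (cut G S).ncard = 2) : RootsDetermine G S e₁ e₂ := by
  obtain ⟨r, hr⟩ : S.Nonempty := by
    induction e₁ with
    | h a b => exact ⟨a, (mk_mem_edgeSet_ind.1 he₁).1⟩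
  have hX := isSide_nearSide hS hb hr
  set X := nearSide G S e₁ r
  have hpos : ∀ Y, IsSide G S e₁ Y → 0 < (cut G S ∩ cut G Y).ncard := by
    intro Y hY
    obtain ⟨d, hd, hne, hc⟩ := hG.exists_ne_mem_cut ((ind G S).edgeSet_subset he₁) hY.mem_cut
    exact (Set.ncard_pos).2 ⟨d, (hY.eq_or_mem_cut hc).resolve_left hne, hc⟩
  have hsum : (cut G S ∩ cut G X).ncard + (cut G S ∩ cut G (S \ X)).ncard = 2 := by
    rw [← Set.ncard_union_eq hX.disjoint_cut, hX.union_cut, h2]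
  have h1 := hpos X hX
  have h1' := hpos _ hX.diff
  obtain ⟨d, hd⟩ := Set.ncard_eq_one.1 (show (cut G S ∩ cut G X).ncard = 1 by omega)
  -- With one cut edge at each side of `e₁`, the pair `{d, e₁}` is a cut of `G`, so a good set using
  -- `d` contains `e₁`.
  have hcutX : cut G X = {d, e₁} := by rw [hX.cut_eq, hd, Set.pair_comm]
  have hdS : d ∈ cut G S := by
    have : d ∈ cut G S ∩ cut G X := by rw [hd]; rfl
    exact this.1
  obtain ⟨x, y, -, hxy⟩ := Set.ncard_eq_two.1 h2
  intro c hc F hF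
  refine hG.wt_eq_zero_of_through ((ind G Sᶜ).edgeSet_subset he₂) (fun J hJ _ he₂J => hc J ?_) hF
    hF.sub
  refine ⟨hJ, ?_⟩
  by_cases hdisj : Disjoint J (cut G S)
  · exact .inr ⟨.inr he₂J, hdisj⟩
  left
  have hsub : cut G S ⊆ J := by
    obtain ⟨e, heJ, heS⟩ := Set.not_disjoint_iff.1 hdisj
    rw [hxy] at heS ⊢
    rcases heS with rfl | rfl
    · exact Set.insert_subset heJ (Set.singleton_subset_iff.2 (hJ.mem_of_cut_eq_pair hxy heJ))
    · rw [Set.pair_comm] at hxy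
      exact Set.insert_subset (hJ.mem_of_cut_eq_pair hxy heJ) (Set.singleton_subset_iff.2 heJ)
  exact ⟨hJ.mem_of_cut_eq_pair hcutX (hsub hdS), he₂J, by rw [Set.inter_eq_right.2 hsub, h2]⟩

end BridgeEdge

/-! ### Cores: the 2-edge-connected component of an edge in an induced subgraph -/

section Core

variable {G : SimpleGraph V} {W : Set V} {e : Sym2 V} {F J : Set (Sym2 V)} {u v x : V}

theorem good_sUnion {𝒥 : Set (Set (Sym2 V))} (h : ∀ J ∈ 𝒥, Good G J) (he : ∀ J ∈ 𝒥, e ∈ J) :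
    Good G (⋃₀ 𝒥) where
  sub := Set.sUnion_subset fun J hJ => (h J hJ).sub
  bridgeless u v := by
    rintro ⟨J, hJ, huv⟩
    exact ((h J hJ).bridgeless u v huv).mono
      (Set.sdiff_subset_sdiff_left (Set.subset_sUnion_of_mem hJ))
  conn := by
    rintro u ⟨d, ⟨J, hJ, hd⟩, hu⟩ v ⟨d', ⟨J', hJ', hd'⟩, hv⟩
    induction e with
    | h a b =>
      exact (((h J hJ).conn u ⟨d, hd, hu⟩ a (mem_covered_left (he J hJ))).mono
        (Set.subset_sUnion_of_mem hJ)).trans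
        (((h J' hJ').conn a (mem_covered_left (he J' hJ')) v ⟨d', hd', hv⟩).mono
        (Set.subset_sUnion_of_mem hJ'))

/-- The largest good set in `G[W]` containing `e`. -/
def core (G : SimpleGraph V) (W : Set V) (e : Sym2 V) : Set (Sym2 V) :=
  ⋃₀ {J | Good G J ∧ J ⊆ (ind G W).edgeSet ∧ e ∈ J}

theorem good_core : Good G (core G W e) := good_sUnion (fun _ hJ => hJ.1) (fun _ hJ => hJ.2.2)

theorem core_subset : core G W e ⊆ (ind G W).edgeSet := Set.sUnion_subset fun _ hJ => hJ.2.1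

theorem subset_core (h : Good G J) (hJ : J ⊆ (ind G W).edgeSet) (he : e ∈ J) : J ⊆ core G W e :=
  Set.subset_sUnion_of_mem ⟨h, hJ, he⟩

theorem covered_core_subset : covered (core G W e) ⊆ W :=
  (covered_mono core_subset).trans (covered_edgeSet_ind_subset W)

theorem exists_good_of_joined (hF : F ⊆ G.edgeSet) (huv : s(u, v) ∈ F)
    (hj : Joined G (F \ {s(u, v)}) u v) : ∃ J, Good G J ∧ J ⊆ F ∧ s(u, v) ∈ J := by
  obtain ⟨p, hp, hpF⟩ := hj.symm.exists_isPath
  have hadj : G.Adj u v := hF huv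
  refine ⟨(Walk.cons hadj p).edgeSet,
    good_of_isTrail (hp.isTrail.cons hadj fun h => (hpF _ h).2 rfl), ?_, by simp⟩
  rw [Walk.edgeSet_cons]
  exact Set.insert_subset huv fun e he => (hpF e he).1

theorem mem_core_self (he : e ∈ (ind G W).edgeSet) (hb : ¬ IsBridgeOf (ind G W) e) :
    e ∈ core G W e := by
  induction e with
  | h a b =>
    rw [isBridgeOf_ind_iff, not_and, not_not] at hb
    obtain ⟨J, hJ, hJW, hab⟩ := exists_good_of_joined (ind G W).edgeSet_subset he (hb he)
    exact subset_core hJ hJW hab hab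

variable (G W e) in
/-- `G[W]` is connected, `e` is an edge of `G[W]` but not a bridge, and the far side of every
bridge of `G[W]` is left by exactly one edge of the cut. -/
structure Half : Prop where
  conn : ConnectedOn G W
  mem : e ∈ (ind G W).edgeSet
  not_bridge : ¬ IsBridgeOf (ind G W) e
  bridge : ∀ f, IsBridgeOf (ind G W) f → (cut G W ∩ cut G (farSide G W e f)).ncard = 1

theorem Half.mem_core (h : Half G W e) : e ∈ core G W e := mem_core_self h.mem h.not_bridge

theorem Half.subset_core (h : Half G W e) (hJ : Good G J) (hJW : J ⊆ (ind G W).edgeSet)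
    (hx : x ∈ covered J) (hx' : x ∈ covered (core G W e)) : J ⊆ core G W e :=
  Set.subset_union_left.trans (TECS.subset_core (hJ.union good_core hx hx')
    (Set.union_subset hJW core_subset) (.inr h.mem_core))

/-- A core path closes such an edge to a cycle, which maximality absorbs: the core is an induced
subgraph. -/
theorem Half.mem_core_of_adj (h : Half G W e) (hu : u ∈ covered (core G W e))
    (hv : v ∈ covered (core G W e)) (hadj : G.Adj u v) : s(u, v) ∈ core G W e := by
  by_contra hn
  have hW : s(u, v) ∈ (ind G W).edgeSet :=
    mk_mem_edgeSet_ind.2 ⟨covered_core_subset hu, covered_core_subset hv, hadj⟩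
  obtain ⟨J, hJ, hJW, huv⟩ := exists_good_of_joined (ind G W).edgeSet_subset hW
    ((good_core.conn u hu v hv).mono fun d hd => ⟨core_subset hd, fun h => hn (h ▸ hd)⟩)
  exact hn (h.subset_core hJ hJW (mem_covered_left huv) hu huv)

/-- A vertex outside the core is cut off from it by a bridge which forms a two-edge cut together
with an edge leaving `W`. -/
theorem Half.exists_bridge (h : Half G W e) (hv : v ∈ W) (hvc : v ∉ covered (core G W e)) :
    ∃ f d, f ∈ (ind G W).edgeSet ∧ f ∈ cut G (covered (core G W e)) ∧ v ∈ farSide G W e f ∧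
      Disjoint (farSide G W e f) (covered (core G W e)) ∧
      cut G W ∩ cut G (farSide G W e f) = {d} ∧ cut G (farSide G W e f) = {f, d} := by
  obtain ⟨x, hxe⟩ : ∃ x, x ∈ e := by
    induction e with
    | h a b => exact ⟨a, by simp⟩
  have hxc : x ∈ covered (core G W e) := ⟨e, h.mem_core, hxe⟩
  obtain ⟨p, hp⟩ := h.conn v hv x (covered_core_subset hxc)
  obtain ⟨z, hz, q, r, rfl, hq, -⟩ :=
    exists_first_visit p (A := covered (core G W e)) ⟨x, by simp, hxc⟩
  have hj : Joined G (ind G W).edgeSet z v := Joined.symm ⟨q, fun d hd => hp d (by simp [hd])⟩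
  classical
  obtain ⟨t, ht, htW, hts⟩ : ∃ t : G.Walk z v, t.IsPath ∧ (∀ d ∈ t.edges, d ∈ (ind G W).edgeSet) ∧
      ∀ a ∈ t.support, a ∈ covered (core G W e) → a = z := by
    refine ⟨q.reverse.bypass, q.reverse.bypass_isPath, fun d hd => hp d ?_, fun a ha => hq a ?_⟩
    · have := q.reverse.edges_bypass_subset_edges hd
      rw [Walk.edges_reverse, List.mem_reverse] at this
      rw [Walk.edges_append, List.mem_append]
      exact .inl this
    · simpa using q.reverse.support_bypass_subset_support ha
  cases t with
  | nil => exact absurd hz hvc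
  | @cons _ z' _ hadj t =>
  rw [Walk.cons_isPath_iff] at ht
  have hz' : z' ∉ covered (core G W e) := fun hz'c =>
    hadj.ne (hts z' (by simp) hz'c).symm
  have hfW : s(z, z') ∈ (ind G W).edgeSet := htW _ (by simp)
  have hfc : s(z, z') ∉ core G W e := fun hmem => hz' (mem_covered_right hmem)
  -- Were the first edge out of the core not a bridge, a cycle through it would enlarge the core.
  have hbr : IsBridgeOf (ind G W) s(z, z') := by
    rw [isBridgeOf_ind_iff]
    refine ⟨hfW, fun hj => hfc ?_⟩
    obtain ⟨J, hJ, hJW, hmem⟩ := exists_good_of_joined (ind G W).edgeSet_subset hfW hj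
    exact h.subset_core hJ hJW (mem_covered_left hmem) hz hmem
  have hcore : ∀ a ∈ covered (core G W e), ∀ b ∈ covered (core G W e),
      Joined G ((ind G W).edgeSet \ {s(z, z')}) a b := fun a ha b hb =>
    (good_core.conn a ha b hb).mono fun d hd => ⟨core_subset hd, fun h => hfc (h ▸ hd)⟩
  have hz'v : Joined G ((ind G W).edgeSet \ {s(z, z')}) z' v := by
    refine ⟨t, fun d hd => ⟨htW d (by simp [hd]), ?_⟩⟩
    rintro rfl
    exact ht.2 (t.fst_mem_support_of_mem_edges hd)
  have hside := isSide_farSide h.conn hbr h.mem (fun he => hfc (he ▸ h.mem_core))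
  obtain ⟨d, hd⟩ := Set.ncard_eq_one.1 (h.bridge _ hbr)
  refine ⟨s(z, z'), d, hfW, mk_mem_cut_iff.2 ⟨hadj, .inl ⟨hz, hz'⟩⟩,
    ⟨hv, fun u hu hvu => ?_⟩, ?_, hd,
    by rw [hside.cut_eq, hd]⟩
  · exact (isBridgeOf_ind_iff.1 hbr).2
      (((hcore z hz u ⟨e, h.mem_core, hu⟩).trans hvu.symm).trans hz'v.symm)
  · exact Set.disjoint_left.2 fun a ha hac => ha.2 x hxe (hcore a hac x hxc)

/-- A good set that crosses the cut touches the core. -/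
theorem Half.exists_mem_covered (h : Half G W e) {d : Sym2 V} (hF : Good G F) (hd : d ∈ F)
    (hdW : d ∈ cut G W) : ∃ x ∈ covered F, x ∈ covered (core G W e) := by
  obtain ⟨hadj, a, ha, b, hb, rfl⟩ := hdW
  by_cases hac : a ∈ covered (core G W e)
  · exact ⟨a, mem_covered_left hd, hac⟩
  obtain ⟨f, d', -, hfc, hfar, -, hd', hcut⟩ := h.exists_bridge ha hac
  have hmem : s(a, b) ∈ cut G W ∩ cut G (farSide G W e f) :=
    ⟨⟨hadj, a, ha, b, hb, rfl⟩, hadj, a, hfar, b, fun h => hb h.1, rfl⟩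
  rw [hd', Set.mem_singleton_iff] at hmem
  rw [Set.pair_comm, ← hmem] at hcut
  have hf := hF.mem_of_cut_eq_pair hcut hd
  obtain ⟨-, x, hx, y, -, rfl⟩ := hfc
  exact ⟨x, mem_covered_left hf, hx⟩

/-- A cut edge `d` with its end in `W` off the core is sent to the bridge paired with it in a
two-edge cut; `d` is recovered as the only cut edge at the far side of that bridge. -/
theorem Half.ncard_le [Finite V] (h : Half G W e) (hF : Good G F) :
    (F ∩ cut G W).ncard ≤ (F ∩ cut G (covered (core G W e))).ncard := by
  have key : ∀ d ∈ F ∩ cut G W, ∃ g ∈ F ∩ cut G (covered (core G W e)),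
      g = d ∨ (g ∈ (ind G W).edgeSet ∧ cut G W ∩ cut G (farSide G W e g) = {d}) := by
    rintro d ⟨hd, hdW⟩
    obtain ⟨hadj, a, ha, b, hb, rfl⟩ := hdW
    by_cases hac : a ∈ covered (core G W e)
    · exact ⟨_, ⟨hd, hadj, a, hac, b, fun h => hb (covered_core_subset h), rfl⟩, .inl rfl⟩
    obtain ⟨f, d', hfW, hfc, hfar, -, hd', hcut⟩ := h.exists_bridge ha hac
    have hmem : s(a, b) ∈ cut G W ∩ cut G (farSide G W e f) :=
      ⟨⟨hadj, a, ha, b, hb, rfl⟩, hadj, a, hfar, b, fun h => hb h.1, rfl⟩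
    rw [hd', Set.mem_singleton_iff] at hmem
    subst hmem
    rw [Set.pair_comm] at hcut
    exact ⟨f, ⟨hF.mem_of_cut_eq_pair hcut hd, hfc⟩, .inr ⟨hfW, hd'⟩⟩
  choose! φ hφ hφ' using key
  refine Set.ncard_le_ncard_of_injOn φ hφ ?_
  intro d hd d' hd' heq
  have hdisj := Set.disjoint_left.1 (disjoint_edgeSet_ind_cut (G := G) W)
  rcases hφ' d hd with h1 | ⟨h1, h2⟩ <;> rcases hφ' d' hd' with h1' | ⟨h1', h2'⟩
  · rw [← h1, ← h1', heq]
  · exact absurd hd.2 (hdisj (h1 ▸ heq ▸ h1'))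
  · exact absurd hd'.2 (hdisj (h1' ▸ heq ▸ h1))
  · rw [heq, h2'] at h2
    exact (Set.singleton_injective h2).symm

/-- Adding an induced subgraph whose boundary is contained in a good set. -/
theorem Good.union_ind {T : Set (Sym2 V)} {X : Set V} (hG : Good G G.edgeSet) (hT : Good G T)
    (hX : cut G X ⊆ T) (hne : (cut G X).Nonempty) : Good G (T ∪ (ind G X).edgeSet) := by
  obtain ⟨_, hadj, a₀, ha₀, b₀, hb₀, rfl⟩ := hne
  have hreach : ∀ h : Sym2 V, ∀ x ∈ X, x ∈ covered G.edgeSet →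
      ∃ t ∈ covered T, Joined G ((ind G X).edgeSet \ {h}) x t := by
    intro h x hx hxG
    -- Even without the edge `h`, the vertex `x` is joined to `b₀` outside `X`; the walk leaves `X`
    -- through an edge of `T`.
    have hj := hG.joined_diff h (hG.conn x hxG b₀ (mem_covered_right hadj))
    obtain ⟨d, hd, hdG, a, ha, b, hb, rfl⟩ := hj.exists_mem_cut
      (X := {w | w ∈ X ∧ Joined G ((ind G X).edgeSet \ {h}) x w}) ⟨hx, .refl x⟩ (fun h => hb₀ h.1)
    refine ⟨a, mem_covered_left (v := b) (hX ⟨hdG, a, ha.1, b, fun hbX => hb ⟨hbX, ?_⟩, rfl⟩), ha.2⟩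
    exact ha.2.trans (Joined.of_mem (Set.sdiff_subset.trans (ind G X).edgeSet_subset)
      ⟨mk_mem_edgeSet_ind.2 ⟨ha.1, hbX, hdG⟩, hd.2⟩)
  refine ⟨Set.union_subset hT.sub (ind G X).edgeSet_subset, fun u v huv => ?_, ?_⟩
  · by_cases hmem : s(u, v) ∈ T
    · exact (hT.bridgeless u v hmem).mono (by gcongr; simp)
    have huvX := huv.resolve_left hmem
    obtain ⟨hu, hv, hadj⟩ := mk_mem_edgeSet_ind.1 huvX
    obtain ⟨t, ht, hut⟩ := hreach s(u, v) u hu (mem_covered_left hadj)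
    obtain ⟨t', ht', hvt⟩ := hreach s(u, v) v hv (mem_covered_right hadj)
    have htt : Joined G ((T ∪ (ind G X).edgeSet) \ {s(u, v)}) t t' :=
      (hT.conn t ht t' ht').mono fun d hd => ⟨.inl hd, fun h => hmem (h ▸ hd)⟩
    exact ((hut.mono (by gcongr; simp)).trans htt).trans (hvt.symm.mono (by gcongr; simp))
  · have key : ∀ u ∈ covered (T ∪ (ind G X).edgeSet), Joined G (T ∪ (ind G X).edgeSet) u a₀ := by
      have ha : a₀ ∈ covered T := mem_covered_left (hX ⟨hadj, a₀, ha₀, b₀, hb₀, rfl⟩)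
      intro u hu
      rw [covered_union] at hu
      rcases hu with hu | hu
      · exact (hT.conn u hu a₀ ha).mono (by simp)
      -- The loop `s(u, u)` is not an edge, so nothing is deleted here.
      · obtain ⟨t, ht, hut⟩ := hreach s(u, u) u (covered_edgeSet_ind_subset X hu)
          (covered_mono (ind G X).edgeSet_subset hu)
        exact (hut.mono (Set.sdiff_subset.trans Set.subset_union_right)).trans
          ((hT.conn t ht a₀ ha).mono (by simp))
    exact fun u hu v hv => (key u hu).trans (key v hv).symm

/-- A weight that vanishes on the edges inside `A` and on the trails from `A` to `A` with interior
outside `A` vanishes on all trails from `A` to `A`. -/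
theorem wt_trail_eq_zero_of_excursions [Finite V] {A : Set V} {c : Sym2 V → ℝ}
    (hin : ∀ a ∈ A, ∀ b ∈ A, G.Adj a b → c s(a, b) = 0)
    (hex : ∀ (a w b : V) (h : G.Adj a w) (q : G.Walk w b), a ∈ A → w ∉ A → b ∈ A →
      (Walk.cons h q).IsTrail → (∀ d ∈ q.edges, ∃ x ∈ d, x ∉ A) →
      (∃ d, ∀ d' ∈ q.edges, (∃ x ∈ d', x ∈ A) → d' = d) → wt c (Walk.cons h q).edgeSet = 0)
    (p : G.Walk u v) (hp : p.IsTrail) (hu : u ∈ A) (hv : v ∈ A) : wt c p.edgeSet = 0 := by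
  induction hn : p.length using Nat.strong_induction_on generalizing u p with
  | _ n ih =>
  cases p with
  | nil => simp [wt_empty]
  | @cons _ w _ h p =>
    by_cases hw : w ∈ A
    · have hp' := Walk.isTrail_cons h p |>.1 hp
      have h1 := ih p.length (by rw [← hn]; simp) p hp'.1 hw rfl
      rw [Walk.edgeSet_cons, ← Set.singleton_union,
        wt_union (Set.disjoint_singleton_left.2 hp'.2), h1, wt_singleton, hin u hu w hw h, add_zero]
    · obtain ⟨b, hb, q, r, rfl, -, hq, hd⟩ := exists_first_visit p (A := A) ⟨v, by simp, hv⟩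
      have heq : Walk.cons h (q.append r) = (Walk.cons h q).append r := by simp
      rw [heq, isTrail_append_iff] at hp
      have hlen : r.length < n := by
        rw [← hn, Walk.length_cons, Walk.length_append]; omega
      rw [heq, edgeSet_append, wt_union hp.2.2, ih r.length hlen r hp.2.1 hb rfl,
        hex u w b h q hu hw hb hp.1 hq hd, add_zero]

end Core

/-! ### Sufficiency when neither edge is a bridge -/

section Sufficiency

variable {G : SimpleGraph V} {S : Set V} {e₁ e₂ : Sym2 V} {F J : Set (Sym2 V)} {c : Sym2 V → ℝ}

variable (G S e₁ e₂) in
/-- Both sides of the cut satisfy `Half`. -/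
structure Setup : Prop where
  good : Good G G.edgeSet
  left : Half G S e₁
  right : Half G Sᶜ e₂

theorem Setup.symm (h : Setup G S e₁ e₂) : Setup G Sᶜ e₂ e₁ :=
  ⟨h.good, h.right, by rw [compl_compl]; exact h.left⟩

theorem ncard_pair_le {α : Type*} (a b : α) : ({a, b} : Set α).ncard ≤ 2 :=
  (Set.ncard_insert_le a {b}).trans (by simp)

theorem disjoint_edgeSet_ind_compl (S : Set V) :
    Disjoint (ind G S).edgeSet (ind G Sᶜ).edgeSet := by
  rw [Set.disjoint_left]
  intro e
  induction e with
  | h a b =>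
    intro h h'
    exact (mk_mem_edgeSet_ind.1 h').1 (mk_mem_edgeSet_ind.1 h).1

theorem core_disjoint_cut (W : Set V) (e : Sym2 V) : Disjoint (core G W e) (cut G W) :=
  (disjoint_edgeSet_ind_cut W).mono_left core_subset

theorem disjoint_core_core : Disjoint (core G S e₁) (core G Sᶜ e₂) :=
  (disjoint_edgeSet_ind_compl S).mono core_subset core_subset

theorem core_right_disjoint_cut : Disjoint (core G Sᶜ e₂) (cut G S) :=
  cut_compl (G := G) S ▸ core_disjoint_cut Sᶜ e₂

theorem Setup.isRoot [Finite V] (h : Setup G S e₁ e₂) (hF : Good G F) (h₁ : e₁ ∈ F) (h₂ : e₂ ∈ F)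
    (h2 : (F ∩ cut G S).ncard ≤ 2) : IsRoot G S e₁ e₂ F :=
  ⟨hF, .inl ⟨h₁, h₂, le_antisymm h2 (hF.two_le_ncard_cut h.left.mem h.right.mem h₁ h₂)⟩⟩

theorem Setup.wt_core_left (h : Setup G S e₁ e₂) (hc : ∀ F, IsRoot G S e₁ e₂ F → wt c F = 0) :
    wt c (core G S e₁) = 0 :=
  hc _ ⟨good_core, .inr ⟨.inl h.left.mem_core, core_disjoint_cut S e₁⟩⟩

theorem Setup.wt_core_right (h : Setup G S e₁ e₂) (hc : ∀ F, IsRoot G S e₁ e₂ F → wt c F = 0) :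
    wt c (core G Sᶜ e₂) = 0 :=
  hc _ ⟨good_core, .inr ⟨.inr h.right.mem_core, core_right_disjoint_cut⟩⟩

/-- Good sets crossing the cut can be enlarged by both cores. -/
theorem Setup.good_union_cores (h : Setup G S e₁ e₂) {d : Sym2 V} (hF : Good G F) (hd : d ∈ F)
    (hdS : d ∈ cut G S) : Good G (F ∪ (core G S e₁ ∪ core G Sᶜ e₂)) := by
  obtain ⟨x, hx, hxc⟩ := h.left.exists_mem_covered hF hd hdS
  obtain ⟨y, hy, hyc⟩ := h.right.exists_mem_covered hF hd (by rwa [cut_compl])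
  rw [← Set.union_assoc]
  exact (hF.union good_core hx hxc).union good_core (covered_mono Set.subset_union_left hy) hyc

theorem union_cores_inter_cut :
    (F ∪ (core G S e₁ ∪ core G Sᶜ e₂)) ∩ cut G S = F ∩ cut G S := by
  rw [Set.union_inter_distrib_right, Set.union_inter_distrib_right,
    (core_disjoint_cut S e₁).inter_eq, core_right_disjoint_cut.inter_eq, Set.union_empty,
    Set.union_empty]

variable [Finite V]

/-- A second cut edge exists since `G` is bridgeless; paths inside the two connected sides close
both edges to a trail. -/
theorem Setup.exists_closed_trail (h : Setup G S e₁ e₂) {d : Sym2 V} (hd : d ∈ cut G S) :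
    ∃ Y, Good G Y ∧ d ∈ Y ∧ (Y ∩ cut G S).ncard ≤ 2 := by
  obtain ⟨b, hb, hbd, hbS⟩ := h.good.exists_ne_mem_cut hd.1 hd
  obtain ⟨hadj, x, hx, y, hy, rfl⟩ := hd
  obtain ⟨hadj', x', hx', y', hy', rfl⟩ := hbS
  obtain ⟨N, hN, hNS⟩ := (h.right.conn y hy y' hy').exists_isPath
  obtain ⟨M, hM, hMS⟩ := (h.left.conn x' hx' x hx).exists_isPath
  have hxy : G.Adj x y := hadj
  have hyx' : G.Adj y' x' := SimpleGraph.Adj.symm hadj'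
  have hcN : ∀ e ∈ N.edges, e ∉ cut G S := fun e he hc =>
    Set.disjoint_left.1 (disjoint_edgeSet_ind_cut Sᶜ) (hNS e he) (by rwa [cut_compl])
  have hcM : ∀ e ∈ M.edges, e ∉ cut G S := fun e he hc =>
    Set.disjoint_left.1 (disjoint_edgeSet_ind_cut S) (hMS e he) hc
  have hdc : s(x, y) ∈ cut G S := ⟨hadj, x, hx, y, hy, rfl⟩
  have hbc : s(y', x') ∈ cut G S := ⟨hyx', x', hx', y', hy', Sym2.eq_swap⟩
  have hne : s(x, y) ≠ s(y', x') := by rw [Sym2.eq_swap (a := y')]; exact hbd.symm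
  refine ⟨(Walk.cons hxy (N.append (.cons hyx' M))).edgeSet, good_of_isTrail ?_, by simp, ?_⟩
  · rw [Walk.isTrail_cons, isTrail_append_iff, Walk.isTrail_cons, Walk.edgeSet_cons,
      Set.disjoint_insert_right]
    refine ⟨⟨hN.isTrail, ⟨hM.isTrail, fun hm => hcM _ hm hbc⟩, fun hm => hcN _ hm hbc, ?_⟩, ?_⟩
    · exact (disjoint_edgeSet_ind_compl S).symm.mono (fun e he => hNS e he) (fun e he => hMS e he)
    · simp only [Walk.edges_append, Walk.edges_cons, List.mem_append, List.mem_cons, not_or]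
      exact ⟨fun hm => hcN _ hm hdc, hne, fun hm => hcM _ hm hdc⟩
  · refine (Set.ncard_le_ncard (t := {s(x, y), s(y', x')}) ?_).trans (ncard_pair_le _ _)
    rintro e ⟨he, hec⟩
    simp only [Walk.mem_edgeSet, Walk.edges_cons, Walk.edges_append, List.mem_cons,
      List.mem_append] at he
    rcases he with rfl | he | rfl | he
    · simp
    · exact absurd hec (hcN e he)
    · simp
    · exact absurd hec (hcM e he)

/-- Good sets inside `G[S]` that do not touch the core have weight zero. -/
theorem Setup.wt_eq_zero_of_disjoint_core (h : Setup G S e₁ e₂)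
    (hc : ∀ F, IsRoot G S e₁ e₂ F → wt c F = 0) (hJ : Good G J) (hJS : J ⊆ (ind G S).edgeSet)
    (hdisj : Disjoint (covered J) (covered (core G S e₁))) : wt c J = 0 := by
  rcases J.eq_empty_or_nonempty with rfl | ⟨e, he⟩
  · exact wt_empty
  obtain ⟨v, hv⟩ : (covered J).Nonempty := by
    induction e with
    | h a b => exact ⟨a, mem_covered_left he⟩
  obtain ⟨f, d, hfS, hfc, hvX, hXc, hd, hcut⟩ := h.left.exists_bridge
    (covered_edgeSet_ind_subset S (covered_mono hJS hv)) (Set.disjoint_left.1 hdisj hv)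
  set X := farSide G S e₁ f with hX
  have hXS : X ⊆ S := fun x hx => hx.1
  have hdS : d ∈ cut G S := by
    have : d ∈ cut G S ∩ cut G X := by rw [hd]; rfl
    exact this.1
  have hfJ : f ∉ J := by
    intro hf
    obtain ⟨-, a, ha, b, -, rfl⟩ := hfc
    exact Set.disjoint_left.1 hdisj (mem_covered_left hf) ha
  -- `J` avoids `f`, hence also its partner `d` in the two-edge cut `δ(X)`.
  have hJX : J ⊆ (ind G X).edgeSet := by
    refine hJ.subset_edgeSet_ind ?_ hv hvX
    rw [hcut, Set.disjoint_left]
    rintro g hg (rfl | rfl)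
    · exact hfJ hg
    · exact hfJ (hJ.mem_of_cut_eq_pair (by rw [hcut, Set.pair_comm]) hg)
  obtain ⟨Y, hY, hdY, hY2⟩ := h.exists_closed_trail hdS
  have hT := h.good_union_cores hY hdY hdS
  have hfY : f ∈ Y := hY.mem_of_cut_eq_pair (by rw [hcut, Set.pair_comm]) hdY
  have hR := h.good.union_ind hT (X := X)
    (by rw [hcut]; exact Set.insert_subset (.inl hfY) (Set.singleton_subset_iff.2 (.inl hdY)))
    (by rw [hcut]; exact ⟨f, by simp⟩)
  have hXSind : (ind G X).edgeSet ⊆ (ind G S).edgeSet := by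
    intro g hg
    induction g with
    | h a b =>
      rw [mk_mem_edgeSet_ind] at hg ⊢
      exact ⟨hXS hg.1, hXS hg.2.1, hg.2.2⟩
  have hR2 : ((Y ∪ (core G S e₁ ∪ core G Sᶜ e₂) ∪ (ind G X).edgeSet) ∩ cut G S).ncard ≤ 2 := by
    rw [Set.union_inter_distrib_right, union_cores_inter_cut,
      ((disjoint_edgeSet_ind_cut S).mono_left hXSind).inter_eq, Set.union_empty]
    exact hY2
  -- A good subset through `d` crosses the cut, so adding both cores makes it a root; the cores
  -- weigh nothing.
  have key := hR.wt_eq_zero_of_through (g := d) (c := (core G S e₁ ∪ core G Sᶜ e₂)ᶜ.indicator c)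
    (.inl (.inl hdY)) (fun I hI hIR hdI => by
      have hroot := h.isRoot (h.good_union_cores hI hdI hdS) (.inr (.inl h.left.mem_core))
        (.inr (.inr h.right.mem_core)) (by
          rw [union_cores_inter_cut]
          exact (Set.ncard_le_ncard (Set.inter_subset_inter_left _ hIR)).trans hR2)
      have h0 := hc _ hroot
      rw [wt_union_eq_add_wt_diff, wt_union disjoint_core_core, h.wt_core_left hc,
        h.wt_core_right hc] at h0
      rw [wt_indicator_compl]
      linarith) hJ (hJX.trans Set.subset_union_right)
  rw [wt_indicator_compl] at key
  rwa [sdiff_eq_left.2] at key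
  rw [Set.disjoint_union_right]
  refine ⟨Set.disjoint_left.2 fun g hg hgc => ?_,
    (disjoint_edgeSet_ind_compl S).mono hJS core_subset⟩
  induction g with
  | h a b => exact Set.disjoint_left.1 hdisj (mem_covered_left hg) (mem_covered_left hgc)

/-- A path inside the core closes the excursion to a closed trail with at most two cut edges. Its
union with both cores is the good set in which the through-an-edge principle is used, with `e₂` as
the fixed edge. -/
theorem Setup.wt_excursion (h : Setup G S e₁ e₂) (hc : ∀ F, IsRoot G S e₁ e₂ F → wt c F = 0)
    {a w b : V} (hadj : G.Adj a w) (q : G.Walk w b) (ha : a ∈ covered (core G S e₁))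
    (hw : w ∉ covered (core G S e₁)) (hb : b ∈ covered (core G S e₁))
    (ht : (Walk.cons hadj q).IsTrail)
    (hq : ∀ d ∈ q.edges, ∃ x ∈ d, x ∉ covered (core G S e₁))
    (hd : ∃ d, ∀ d' ∈ q.edges, (∃ x ∈ d', x ∈ covered (core G S e₁)) → d' = d) :
    wt ((core G S e₁)ᶜ.indicator c) (Walk.cons hadj q).edgeSet = 0 := by
  obtain ⟨M, hM, hMc⟩ := (good_core.conn b hb a ha).exists_isPath
  have hdisj : Disjoint (Walk.cons hadj q).edgeSet (core G S e₁) := by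
    rw [Walk.edgeSet_cons, Set.disjoint_insert_left]
    refine ⟨fun hmem => hw (mem_covered_right hmem), Set.disjoint_left.2 fun g hg hgc => ?_⟩
    obtain ⟨x, hx, hxc⟩ := hq g hg
    exact hxc ⟨g, hgc, hx⟩
  set Y := ((Walk.cons hadj q).append M).edgeSet with hYdef
  have hYeq : Y = (Walk.cons hadj q).edgeSet ∪ M.edgeSet := edgeSet_append _ _
  have hY : Good G Y := good_of_isTrail
    (isTrail_append_iff.2 ⟨ht, hM.isTrail, hdisj.mono_right fun e he => hMc e he⟩)
  have haw : s(a, w) ∈ Y := by simp [hYeq]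
  have hY2 : (Y ∩ cut G S).ncard ≤ 2 := by
    obtain ⟨d, hd⟩ := hd
    -- Only the first and the last edge of the excursion leave the vertex set of the core.
    refine (h.left.ncard_le hY).trans ((Set.ncard_le_ncard (t := {s(a, w), d}) ?_).trans
      (ncard_pair_le _ _))
    rintro g ⟨hg, -, x, hx, y, hy, rfl⟩
    rw [hYeq, Walk.edgeSet_cons] at hg
    rcases hg with (hg | hg) | hg
    · exact .inl hg
    · exact .inr (hd _ hg ⟨x, by simp, hx⟩)
    · exact absurd (mem_covered_right (hMc _ hg)) hy
  -- If `w` is in `S`, it lies behind a two-edge cut `{f, d}` that `Y` crosses, so `Y` contains the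
  -- cut edge `d`.
  obtain ⟨d₀, hd₀, hd₀S⟩ : ∃ d ∈ Y, d ∈ cut G S := by
    by_cases hwS : w ∈ S
    · obtain ⟨f, d, -, -, hwX, hXc, hdX, hcut⟩ := h.left.exists_bridge hwS hw
      have hdS : d ∈ cut G S := by
        have : d ∈ cut G S ∩ cut G (farSide G S e₁ f) := by rw [hdX]; rfl
        exact this.1
      obtain ⟨g, hg, hgc⟩ := hY.exists_mem_cut (mem_covered_right haw) (mem_covered_left haw) hwX
        (fun hX => Set.disjoint_left.1 hXc hX ha)
      rw [hcut] at hgc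
      rcases hgc with rfl | rfl
      · exact ⟨d, hY.mem_of_cut_eq_pair hcut hg, hdS⟩
      · exact ⟨g, hg, hdS⟩
    · exact ⟨_, haw, hadj, a, covered_core_subset ha, w, hwS, rfl⟩
  have hR := h.good_union_cores hY hd₀ hd₀S
  have key := hR.wt_eq_zero_of_through (g := e₂) (c := (core G S e₁)ᶜ.indicator c)
    (.inr (.inr h.right.mem_core)) (fun I hI hIR heI => by
      rw [wt_indicator_compl]
      -- If `I` misses the cut it lies beyond it and is a root itself; otherwise it becomes a root
      -- after adding the core of `e₁`.
      by_cases hIS : Disjoint I (cut G S)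
      · have hIsub : I ⊆ (ind G Sᶜ).edgeSet := by
          induction e₂ with
          | h x y =>
            exact hI.subset_edgeSet_ind (by rwa [cut_compl]) (mem_covered_left heI)
              (mk_mem_edgeSet_ind.1 h.right.mem).1
        rw [sdiff_eq_left.2 ((disjoint_edgeSet_ind_compl S).symm.mono hIsub core_subset)]
        exact hc _ ⟨hI, .inr ⟨.inr heI, hIS⟩⟩
      · obtain ⟨d, hdI, hdS⟩ := Set.not_disjoint_iff.1 hIS
        obtain ⟨x, hx, hxc⟩ := h.left.exists_mem_covered hI hdI hdS
        have h0 := hc _ (h.isRoot (hI.union good_core hx hxc) (.inr h.left.mem_core) (.inl heI) (by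
          rw [Set.union_inter_distrib_right, (core_disjoint_cut S e₁).inter_eq, Set.union_empty]
          refine (Set.ncard_le_ncard (Set.inter_subset_inter_left _ hIR)).trans ?_
          rwa [union_cores_inter_cut]))
        rw [wt_union_eq_add_wt_diff, h.wt_core_left hc] at h0
        linarith) hY Set.subset_union_left
  rw [wt_indicator_compl] at key ⊢
  rwa [hYeq, Set.union_sdiff_distrib, Set.sdiff_eq_empty.2 (show M.edgeSet ⊆ core G S e₁ from hMc),
    Set.union_empty] at key

/-- A weight vanishing on the roots vanishes on every good set outside the core of `e₁`. -/
theorem Setup.wt_diff_core (h : Setup G S e₁ e₂) (hc : ∀ F, IsRoot G S e₁ e₂ F → wt c F = 0)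
    (hF : Good G F) : wt c (F \ core G S e₁) = 0 := by
  classical
  rw [← wt_indicator_compl]
  refine hF.wt_eq_zero fun u p hp _ => ?_
  by_cases htouch : ∃ x ∈ covered p.edgeSet, x ∈ covered (core G S e₁)
  · obtain ⟨x, hx, hxc⟩ := htouch
    have hxp := mem_support_of_mem_covered hx
    have hrot : (p.rotate x hxp).edgeSet = p.edgeSet := by
      ext g; exact (p.rotate_edges x hxp).mem_iff
    rw [← hrot]
    refine wt_trail_eq_zero_of_excursions (A := covered (core G S e₁)) ?_ ?_ _
      ((Walk.isTrail_rotate hxp).2 hp) hxc hxc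
    · intro a ha b hb hab
      simp [h.left.mem_core_of_adj ha hb hab]
    · intro a w b hadj q ha hw hb ht hq hd
      exact h.wt_excursion hc hadj q ha hw hb ht hq hd
  · push Not at htouch
    have hgood := good_of_isTrail hp
    have hcov : Disjoint (covered p.edgeSet) (covered (core G S e₁)) :=
      Set.disjoint_left.2 htouch
    have hdisj : Disjoint p.edgeSet (core G S e₁) := by
      rw [Set.disjoint_left]
      intro g hg hgc
      induction g with
      | h a b => exact htouch a (mem_covered_left hg) (mem_covered_left hgc)
    rw [wt_indicator_compl, sdiff_eq_left.2 hdisj]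
    have hcut : Disjoint p.edgeSet (cut G S) := by
      rw [Set.disjoint_left]
      intro d hd hdS
      obtain ⟨x, hx, hxc⟩ := h.left.exists_mem_covered hgood hd hdS
      exact htouch x hx hxc
    rcases p.edgeSet.eq_empty_or_nonempty with hemp | ⟨g, hg⟩
    · rw [hemp, wt_empty]
    obtain ⟨v, hv⟩ : (covered p.edgeSet).Nonempty := by
      induction g with
      | h a b => exact ⟨a, mem_covered_left hg⟩
    by_cases hvS : v ∈ S
    · exact h.wt_eq_zero_of_disjoint_core hc hgood (hgood.subset_edgeSet_ind hcut hv hvS) hcov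
    have hsub : p.edgeSet ⊆ (ind G Sᶜ).edgeSet :=
      hgood.subset_edgeSet_ind (by rwa [cut_compl]) hv hvS
    by_cases htouch' : ∃ x ∈ covered p.edgeSet, x ∈ covered (core G Sᶜ e₂)
    · obtain ⟨x, hx, hxc⟩ := htouch'
      refine good_core.wt_eq_zero_of_through h.right.mem_core (fun I hI hIc heI => ?_) hgood
        (h.right.subset_core hgood hsub hx hxc)
      exact hc _ ⟨hI, .inr ⟨.inr heI, core_right_disjoint_cut.mono_left hIc⟩⟩
    · push Not at htouch'
      refine h.symm.wt_eq_zero_of_disjoint_core (fun F hF => hc F ?_) hgood hsub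
        (Set.disjoint_left.2 htouch')
      have := hF.symm
      rwa [compl_compl] at this

theorem Setup.rootsDetermine (h : Setup G S e₁ e₂) : RootsDetermine G S e₁ e₂ := by
  intro c hc F hF
  have h1 := h.wt_diff_core hc hF
  have h2 : wt c (F \ core G Sᶜ e₂) = 0 := h.symm.wt_diff_core (fun F hF => hc F (by
    have := hF.symm
    rwa [compl_compl] at this)) hF
  -- The weight set to zero on the second core still vanishes on roots: crossing roots absorb that
  -- core, roots in `G[S]` avoid it, and the remaining ones lie inside it.
  have h3 : wt ((core G Sᶜ e₂)ᶜ.indicator c) (F \ core G S e₁) = 0 := by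
    refine h.wt_diff_core (fun J hJ => ?_) hF
    rw [wt_indicator_compl]
    obtain ⟨hJ, ⟨h₁, h₂, h2⟩ | ⟨he, hdisj⟩⟩ := hJ
    · have hun : Good G (J ∪ core G Sᶜ e₂) := by
        induction e₂ with
        | h a b =>
          exact hJ.union good_core (mem_covered_left h₂) (mem_covered_left h.right.mem_core)
      have h0 := hc _ (h.isRoot hun (.inl h₁) (.inl h₂) (by
        rw [Set.union_inter_distrib_right, core_right_disjoint_cut.inter_eq, Set.union_empty, h2]))
      rw [wt_union_eq_add_wt_diff, h.wt_core_right hc] at h0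
      linarith
    · rcases he with he | he
      · have hsub : J ⊆ (ind G S).edgeSet := by
          induction e₁ with
          | h a b =>
            exact hJ.subset_edgeSet_ind hdisj (mem_covered_left he)
              (mk_mem_edgeSet_ind.1 h.left.mem).1
        rw [sdiff_eq_left.2 ((disjoint_edgeSet_ind_compl S).mono hsub core_subset)]
        exact hc _ ⟨hJ, .inr ⟨.inl he, hdisj⟩⟩
      · have hsub : J ⊆ (ind G Sᶜ).edgeSet := by
          induction e₂ with
          | h a b =>
            exact hJ.subset_edgeSet_ind (by rwa [cut_compl]) (mem_covered_left he)
              (mk_mem_edgeSet_ind.1 h.right.mem).1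
        rw [Set.sdiff_eq_empty.2 (subset_core hJ hsub he), wt_empty]
  rw [wt_indicator_compl] at h3
  -- The parts of `F` outside the first core, outside the second and outside both weigh zero; as the
  -- cores are disjoint, so does `F`.
  have h4 := wt_inter_add_wt_diff (c := c) (F := F) (K := core G S e₁)
  have h5 := wt_inter_add_wt_diff (c := c) (F := F \ core G Sᶜ e₂) (K := core G S e₁)
  have h6 : (F \ core G Sᶜ e₂) ∩ core G S e₁ = F ∩ core G S e₁ := by
    ext g
    have : g ∈ core G S e₁ → g ∉ core G Sᶜ e₂ := fun h => Set.disjoint_left.1 disjoint_core_core h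
    simp only [Set.mem_inter_iff, Set.mem_sdiff]
    tauto
  have h7 : (F \ core G Sᶜ e₂) \ core G S e₁ = (F \ core G S e₁) \ core G Sᶜ e₂ :=
    sdiff_right_comm _ _ _
  rw [h6, h7] at h5
  linarith

end Sufficiency

end TECS

theorem mainTheorem6 {V : Type*} [Finite V] (G : SimpleGraph V)
    (hG : G.IsEdgeConnected 2)
    (S : Set V) (hS : S.Nonempty) (hS' : S ≠ Set.univ)
    (hmin : Minimal (TECS.IsCut G) (TECS.cut G S))
    (e₁ e₂ : G.edgeSet)
    (he₁ : (e₁ : Sym2 V) ∈ (TECS.ind G S).edgeSet)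
    (he₂ : (e₂ : Sym2 V) ∈ (TECS.ind G Sᶜ).edgeSet) :
    TECS.DefinesFacet (TECS.TECSP G) (TECS.connectivityCutForm G S e₁ e₂) 2 ↔
      ((TECS.IsBridgeOf (TECS.ind G S) e₁ ∨ TECS.IsBridgeOf (TECS.ind G Sᶜ) e₂) ∧
          (TECS.cut G S).ncard = 2) ∨
        ((¬ TECS.IsBridgeOf (TECS.ind G S) e₁ ∧ ¬ TECS.IsBridgeOf (TECS.ind G Sᶜ) e₂) ∧
          ∀ W : Set V, (W = S ∨ W = Sᶜ) → ∀ f : Sym2 V, TECS.IsBridgeOf (TECS.ind G W) f →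
            (TECS.bridgeCut G W e₁ e₂ f).ncard = 1) := by
  have hgood := TECS.good_edgeSet_self hG
  have hpre := hG.preconnected (by simp)
  have hcon : TECS.ConnectedOn G S := TECS.connectedOn_of_minimal hpre hS' hmin
  have hcon' : TECS.ConnectedOn G Sᶜ := TECS.connectedOn_of_minimal hpre
    (by rw [Ne, Set.compl_univ_iff]; exact hS.ne_empty) (by rwa [TECS.cut_compl])
  have he₁' : (e₁ : Sym2 V) ∈ (TECS.ind G Sᶜᶜ).edgeSet := by rwa [compl_compl]
  rw [TECS.definesFacet_iff he₁ he₂]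
  constructor
  · intro h
    by_cases h₁ : TECS.IsBridgeOf (TECS.ind G S) e₁
    · exact .inl ⟨.inl h₁, h.ncard_cut_eq_two hgood hcon he₁ he₂ h₁⟩
    by_cases h₂ : TECS.IsBridgeOf (TECS.ind G Sᶜ) e₂
    · have := h.symm.ncard_cut_eq_two hgood hcon' he₂ he₁' h₂
      rw [TECS.cut_compl] at this
      exact .inl ⟨.inr h₂, this⟩
    refine .inr ⟨⟨h₁, h₂⟩, ?_⟩
    rintro W (rfl | rfl) f hf
    · exact h.ncard_bridgeCut hgood hcon he₁ he₂ h₁ hf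
    · rw [TECS.bridgeCut_comm]
      exact h.symm.ncard_bridgeCut hgood hcon' he₂ he₁' h₂ hf
  · rintro (⟨h₁ | h₂, hcard⟩ | ⟨⟨h₁, h₂⟩, hbr⟩)
    · exact TECS.rootsDetermine_of_isBridgeOf hgood hcon he₁ he₂ h₁ hcard
    · have := (TECS.rootsDetermine_of_isBridgeOf hgood hcon' he₂ he₁' h₂
        (by rwa [TECS.cut_compl])).symm
      rwa [compl_compl] at this
    · refine TECS.Setup.rootsDetermine ⟨hgood, ⟨hcon, he₁, h₁, fun f hf => ?_⟩,
        ⟨hcon', he₂, h₂, fun f hf => ?_⟩⟩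
      · rw [← TECS.bridgeCut_eq he₂]
        exact hbr S (.inl rfl) f hf
      · rw [← TECS.bridgeCut_eq he₁', TECS.bridgeCut_comm]
        exact hbr Sᶜ (.inr rfl) f hf
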